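/- Let $L,\rho_1,\rho_2,k,b,\gamma>0$ be constants. All functions are real valued, $\langle\cdot,\cdot\rangle$ and $\|\cdot\|$ are the inner product and norm of $L^2(0,L)$, subscripts $x$ denote weak derivatives, and values at $0$ and $L$ are those of the continuous representative. Let $H^1_*(0,L)=\{f\in H^1(0,L): f(0)=0\}$ and $$\mathcal H=\left[H^1_*(0,L)\times L^2(0,L)\right]^3\times\mathbb R^3,\qquad U=(w,\Psi_1,\xi,\Psi_2,s,\Psi_3,\Psi_4,\Psi_5,\Psi_6)\in\mathcal H,$$ endowed with the inner product $$\begin{aligned}\langle U,U^\sharp\rangle_{\mathcal H}={}&3\rho_1\langle\Psi_1,\Psi_1^\sharp\rangle+3\rho_2\langle\Psi_2,\Psi_2^\sharp\rangle+\rho_2\langle\Psi_3,\Psi_3^\sharp\rangle+3b\langle\xi_x,\xi_x^\sharp\rangle+b\langle s_x,s_x^\sharp\rangle+\gamma\langle s,s^\sharp\rangle\\&+3k\langle w_x+\xi+s,\,w_x^\sharp+\xi^\sharp+s^\sharp\rangle+3k\Psi_4\Psi_4^\sharp+3b\Psi_5\Psi_5^\sharp+b\Psi_6\Psi_6^\sharp\end{aligned}$$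 and the corresponding norm $\|\cdot\|_{\mathcal H}$. Let $D(\mathcal A)$ be the set of all $U\in\mathcal H$ with $w,\xi,s\in H^2(0,L)\cap H^1_*(0,L)$, $\Psi_1,\Psi_2,\Psi_3\in H^1_*(0,L)$, $\Psi_4=\Psi_1(L)$, $\Psi_5=\Psi_2(L)$, $\Psi_6=\Psi_3(L)$, equipped with the graph norm $\|U\|_{\mathcal H}+\|\mathcal AU\|_{\mathcal H}$, where $\mathcal A:D(\mathcal A)\subset\mathcal H\to\mathcal H$ is given by $$\mathcal AU=\begin{bmatrix}\Psi_1\\ \frac1{\rho_1}\,k(w_x+\xi+s)_x\\ \Psi_2\\ \frac1{\rho_2}\left[b\xi_{xx}-k(w_x+\xi+s)\right]\\ \Psi_3\\ \frac1{\rho_2}\left[bs_{xx}-3k(w_x+\xi+s)-\gamma s\right]\\ -(w_x(L)+\xi(L)+s(L))\\ -\xi_x(L)\\ -s_x(L)\end{bmatrix}.$$ **Theorem.** For every $U_0\in D(\mathcal A)$, the problem $U_t=\mathcal AU$ $(t\ge0)$, $U(0)=U_0$, has a unique solution $$U\in C([0,\infty);D(\mathcal A))\cap C^1([0,\infty);\mathcal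 H),$$ and it satisfies $\|U(t)\|_{\mathcal H}^2=\|U_0\|_{\mathcal H}^2$ for all $t\ge0$. -/

import Mathlib

open MeasureTheory Set Topology
open scoped ContDiff

noncomputable section

/-- Smooth real functions with compact support contained in the open interval `(0, L)`. -/
structure IsTestFunction (L : ℝ) (φ : ℝ → ℝ) : Prop where
  contDiff : ContDiff ℝ ∞ φ
  hasCompactSupport : HasCompactSupport φ
  tsupport_subset : tsupport φ ⊆ Ioo 0 L

/-- The Lebesgue space `L²(0, L)` of real functions. -/
abbrev L2 (L : ℝ) : Type := Lp ℝ 2 (volume.restrict (Ioo 0 L))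

/-- `g` is a weak (distributional) derivative of `f` on `(0, L)`. -/
def HasWeakDeriv {L : ℝ} (f g : L2 L) : Prop :=
  ∀ φ : ℝ → ℝ, IsTestFunction L φ →
    ∫ x in Ioo 0 L, f x * deriv φ x = -∫ x in Ioo 0 L, g x * φ x

/-- A continuous representative, on the closed interval `[0, L]`, of an element of `L²(0, L)`. -/
def IsContRep {L : ℝ} (f : L2 L) (u : ℝ → ℝ) : Prop :=
  ContinuousOn u (Icc 0 L) ∧ f =ᵐ[volume.restrict (Ioo 0 L)] u

open Classical in
/-- The weak derivative `f_x ∈ L²(0, L)` of `f` (and `0` if there is none). -/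
def weakDeriv {L : ℝ} (f : L2 L) : L2 L :=
  if h : ∃ g : L2 L, HasWeakDeriv f g then h.choose else 0

open Classical in
/-- The value at `x ∈ [0, L]` of the continuous representative of `f` (and `0` if there is none). -/
def pointValue {L : ℝ} (f : L2 L) (x : ℝ) : ℝ :=
  if h : ∃ u : ℝ → ℝ, IsContRep f u then h.choose x else 0

theorem exists_ae_eq_const_of_integral_mul_deriv_eq_zero {L : ℝ} (hL : 0 < L) {f : ℝ → ℝ}
    (hf : IntegrableOn f (Ioo 0 L))
    (h : ∀ φ : ℝ → ℝ, IsTestFunction L φ → ∫ x in Ioo 0 L, f x * deriv φ x = 0) :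
    ∃ c : ℝ, ∀ᵐ x ∂volume.restrict (Ioo 0 L), f x = c := by
  let B : ContDiffBump (L / 2) := ⟨L / 8, L / 4, by positivity, by linarith⟩
  let ψ : ℝ → ℝ := B.normed volume
  have hψc : ContDiff ℝ ∞ ψ := B.contDiff_normed
  have hψs : tsupport ψ ⊆ Ioo 0 L := by
    rw [B.tsupport_normed_eq, Real.closedBall_eq_Icc]
    intro x hx
    have h1 : L / 2 - L / 4 ≤ x := hx.1
    have h2 : x ≤ L / 2 + L / 4 := hx.2
    constructor <;> linarith
  have hψk : HasCompactSupport ψ := B.hasCompactSupport_normed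
  have hψi : ∫ x, ψ x = 1 := B.integral_normed
  have hmul : ∀ φ : ℝ → ℝ, Continuous φ → HasCompactSupport φ →
      Integrable (fun x => f x * φ x) (volume.restrict (Ioo 0 L)) := by
    intro φ h1 h2
    obtain ⟨C, hC⟩ := h2.exists_bound_of_continuous h1
    exact Integrable.mul_bdd (c := C) hf h1.aestronglyMeasurable (Filter.Eventually.of_forall hC)
  refine ⟨∫ x in Ioo 0 L, f x * ψ x, ?_⟩
  set c := ∫ x in Ioo 0 L, f x * ψ x with hc
  have key : ∀ φ : ℝ → ℝ, IsTestFunction L φ →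
      ∫ x in Ioo 0 L, f x * φ x = c * ∫ x, φ x := by
    intro φ hφ
    set m := ∫ x, φ x with hm
    let θ : ℝ → ℝ := fun x => φ x - m * ψ x
    have hθc : ContDiff ℝ ∞ θ := hφ.contDiff.sub (contDiff_const.mul hψc)
    have hφint : Integrable φ := hφ.contDiff.continuous.integrable_of_hasCompactSupport hφ.hasCompactSupport
    have hψint : Integrable ψ := hψc.continuous.integrable_of_hasCompactSupport hψk
    have hθ0 : ∫ x, θ x = 0 := by
      have : ∫ x, θ x = (∫ x, φ x) - ∫ x, m * ψ x := integral_sub hφint (hψint.const_mul m)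
      rw [this, integral_const_mul, hψi, mul_one, sub_self]
    let K : Set ℝ := insert (L / 2) (tsupport φ ∪ tsupport ψ)
    have hK : IsCompact K := (hφ.hasCompactSupport.isCompact.union hψk.isCompact).insert _
    have hKne : K.Nonempty := ⟨_, mem_insert _ _⟩
    have hKs : K ⊆ Ioo 0 L := insert_subset ⟨by linarith, by linarith⟩
      (union_subset hφ.tsupport_subset hψs)
    obtain ⟨a, haK, ha⟩ := hK.exists_isLeast hKne
    obtain ⟨b, hbK, hb⟩ := hK.exists_isGreatest hKne
    have hθK : ∀ x, x ∉ K → θ x = 0 := by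
      intro x hx
      have h1 : φ x = 0 := image_eq_zero_of_notMem_tsupport
        (fun h' => hx (Or.inr (Or.inl h')))
      have h2 : ψ x = 0 := image_eq_zero_of_notMem_tsupport
        (fun h' => hx (Or.inr (Or.inr h')))
      simp [θ, h1, h2]
    let Φ : ℝ → ℝ := fun x => ∫ y in (0 : ℝ)..x, θ y
    have hΦd : ∀ x, HasDerivAt Φ (θ x) x := fun x =>
      intervalIntegral.integral_hasDerivAt_right (hθc.continuous.intervalIntegrable _ _)
        (hθc.continuous.stronglyMeasurableAtFilter _ _) hθc.continuous.continuousAt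
    have hΦd' : deriv Φ = θ := funext fun x => (hΦd x).deriv
    have hΦc : ContDiff ℝ ∞ Φ := contDiff_infty_iff_deriv.2
      ⟨fun x => (hΦd x).differentiableAt, by rw [hΦd']; exact hθc⟩
    have hΦ0 : ∀ x, x ∉ Icc a b → Φ x = 0 := by
      intro x hx
      rcases lt_or_ge x a with hxa | hxa
      · have : ∫ y in (0 : ℝ)..x, θ y = ∫ y in (0 : ℝ)..x, (0 : ℝ) := by
          refine intervalIntegral.integral_congr fun y hy => hθK y fun hyK => ?_
          have h1 := ha hyK
          have h2 : y ≤ max 0 x := hy.2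
          have h3 : max 0 x < a := max_lt (hKs haK).1 hxa
          linarith
        simpa [Φ] using this
      · have hxb : b < x := by
          by_contra hh
          exact hx ⟨hxa, not_lt.1 hh⟩
        have : ∫ y in (0 : ℝ)..x, θ y = ∫ y, θ y := by
          refine intervalIntegral.integral_eq_integral_of_support_subset fun y hy => ?_
          have hyK : y ∈ K := by
            by_contra hh
            exact hy (hθK y hh)
          exact ⟨(hKs hyK).1, (hb hyK).trans hxb.le⟩
        simpa [Φ, hθ0] using this
    have hΦts : tsupport Φ ⊆ Icc a b := closure_minimal
      (fun x hx => by by_contra hh; exact hx (hΦ0 x hh)) isClosed_Icc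
    have hΦT : IsTestFunction L Φ := ⟨hΦc,
      HasCompactSupport.of_support_subset_isCompact isCompact_Icc
        ((subset_tsupport _).trans hΦts),
      hΦts.trans fun x hx => ⟨(hKs haK).1.trans_le hx.1, hx.2.trans_lt (hKs hbK).2⟩⟩
    have h0 := h Φ hΦT
    rw [hΦd'] at h0
    have h1 : ∫ x in Ioo 0 L, f x * θ x
        = (∫ x in Ioo 0 L, f x * φ x) - ∫ x in Ioo 0 L, m * (f x * ψ x) := by
      rw [← integral_sub (hmul φ hφ.contDiff.continuous hφ.hasCompactSupport)
        ((hmul ψ hψc.continuous hψk).const_mul m)]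
      refine integral_congr_ae (Filter.Eventually.of_forall fun x => ?_)
      simp only [θ]; ring
    rw [h1, integral_const_mul] at h0
    rw [hc]; linarith
  have hfin := isOpen_Ioo.ae_eq_zero_of_integral_contDiff_smul_eq_zero (μ := volume)
    (U := Ioo 0 L) (f := (Ioo 0 L).indicator fun x => f x - c) ?_ ?_
  · rw [ae_restrict_iff' measurableSet_Ioo]
    filter_upwards [hfin] with x hx hxI
    have := hx hxI
    rw [indicator_of_mem hxI] at this
    linarith
  · refine Integrable.locallyIntegrable ?_ |>.locallyIntegrableOn _
    rw [integrable_indicator_iff measurableSet_Ioo]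
    exact hf.sub (integrableOn_const (by simp))
  · intro φ h1 h2 h3
    have hφ : IsTestFunction L φ := ⟨h1, h2, h3⟩
    have e1 : (fun x => φ x • (Ioo 0 L).indicator (fun x => f x - c) x)
        = (Ioo 0 L).indicator fun x => f x * φ x - c * φ x := by
      funext x
      by_cases hx : x ∈ Ioo 0 L
      · simp only [indicator_of_mem hx, smul_eq_mul]; ring
      · simp [indicator_of_notMem hx]
    have e2 : ∫ x in Ioo 0 L, φ x = ∫ x, φ x :=
      setIntegral_eq_integral_of_forall_compl_eq_zero fun x hx =>
        image_eq_zero_of_notMem_tsupport fun h' => hx (h3 h')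
    rw [e1, integral_indicator measurableSet_Ioo, integral_sub
      (hmul φ h1.continuous h2)
      ((h1.continuous.integrable_of_hasCompactSupport h2).integrableOn.const_mul c),
      integral_const_mul, key φ hφ, e2, sub_self]

theorem IsTestFunction.integrable_mul {L : ℝ} {φ : ℝ → ℝ} (hφ : IsTestFunction L φ) {f : ℝ → ℝ}
    (hf : IntegrableOn f (Ioo 0 L)) :
    Integrable (fun x => f x * φ x) (volume.restrict (Ioo 0 L)) := by
  obtain ⟨C, hC⟩ := hφ.hasCompactSupport.exists_bound_of_continuous hφ.contDiff.continuous
  exact Integrable.mul_bdd (c := C) hf hφ.contDiff.continuous.aestronglyMeasurable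
    (Filter.Eventually.of_forall hC)

theorem IsTestFunction.deriv {L : ℝ} {φ : ℝ → ℝ} (hφ : IsTestFunction L φ) :
    IsTestFunction L (deriv φ) :=
  ⟨(contDiff_infty_iff_deriv.1 hφ.contDiff).2, hφ.hasCompactSupport.deriv,
    (tsupport_deriv_subset).trans hφ.tsupport_subset⟩

theorem L2.integrableOn {L : ℝ} (f : L2 L) : IntegrableOn f (Ioo 0 L) :=
  (Lp.memLp f).integrable (by norm_num)

theorem HasWeakDeriv.unique {L : ℝ} {f g₁ g₂ : L2 L} (h₁ : HasWeakDeriv f g₁)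
    (h₂ : HasWeakDeriv f g₂) : g₁ = g₂ := by
  have hfin := isOpen_Ioo.ae_eq_zero_of_integral_contDiff_smul_eq_zero (μ := volume)
    (U := Ioo 0 L) (f := (Ioo 0 L).indicator fun x => g₁ x - g₂ x) ?_ ?_
  · refine Lp.ext ?_
    refine (ae_restrict_iff' measurableSet_Ioo).2 ?_
    filter_upwards [hfin] with x hx hxI
    have := hx hxI
    rw [indicator_of_mem hxI] at this
    linarith
  · refine Integrable.locallyIntegrable ?_ |>.locallyIntegrableOn _
    rw [integrable_indicator_iff measurableSet_Ioo]
    exact g₁.integrableOn.sub g₂.integrableOn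
  · intro φ a1 a2 a3
    have hφ : IsTestFunction L φ := ⟨a1, a2, a3⟩
    have e1 : (fun x => φ x • (Ioo 0 L).indicator (fun x => g₁ x - g₂ x) x)
        = (Ioo 0 L).indicator fun x => g₁ x * φ x - g₂ x * φ x := by
      funext x
      by_cases hx : x ∈ Ioo 0 L
      · simp only [indicator_of_mem hx, smul_eq_mul]; ring
      · simp [indicator_of_notMem hx]
    rw [e1, integral_indicator measurableSet_Ioo, integral_sub
      (hφ.integrable_mul g₁.integrableOn) (hφ.integrable_mul g₂.integrableOn)]
    have := h₁ φ hφ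
    have := h₂ φ hφ
    linarith

theorem HasWeakDeriv.weakDeriv_eq {L : ℝ} {f g : L2 L} (h : HasWeakDeriv f g) :
    weakDeriv f = g := by
  have hex : ∃ g : L2 L, HasWeakDeriv f g := ⟨g, h⟩
  rw [weakDeriv, dif_pos hex]
  exact hex.choose_spec.unique h

theorem HasWeakDeriv.add {L : ℝ} {f₁ f₂ g₁ g₂ : L2 L} (h₁ : HasWeakDeriv f₁ g₁)
    (h₂ : HasWeakDeriv f₂ g₂) : HasWeakDeriv (f₁ + f₂) (g₁ + g₂) := by
  intro φ hφ
  have aux : ∀ (u v : L2 L) (θ : ℝ → ℝ), IsTestFunction L θ →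
      ∫ x in Ioo 0 L, (u + v : L2 L) x * θ x
        = (∫ x in Ioo 0 L, u x * θ x) + ∫ x in Ioo 0 L, v x * θ x := by
    intro u v θ hθ
    rw [← integral_add (hθ.integrable_mul u.integrableOn) (hθ.integrable_mul v.integrableOn)]
    refine integral_congr_ae ?_
    filter_upwards [Lp.coeFn_add u v] with x hx
    rw [hx, Pi.add_apply, add_mul]
  rw [aux _ _ _ hφ, aux _ _ _ hφ.deriv, h₁ φ hφ, h₂ φ hφ]
  ring

theorem HasWeakDeriv.smul {L : ℝ} {f g : L2 L} (c : ℝ) (h : HasWeakDeriv f g) :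
    HasWeakDeriv (c • f) (c • g) := by
  intro φ hφ
  have aux : ∀ (u : L2 L) (θ : ℝ → ℝ), ∫ x in Ioo 0 L, (c • u : L2 L) x * θ x
        = c * ∫ x in Ioo 0 L, u x * θ x := by
    intro u θ
    rw [← integral_const_mul]
    refine integral_congr_ae ?_
    filter_upwards [Lp.coeFn_smul c u] with x hx
    rw [hx, Pi.smul_apply, smul_eq_mul, mul_assoc]
  rw [aux, aux, h φ hφ]
  ring

theorem HasWeakDeriv.zero {L : ℝ} : HasWeakDeriv (0 : L2 L) 0 := by
  have aux : ∀ θ : ℝ → ℝ, ∫ x in Ioo 0 L, (0 : L2 L) x * θ x = 0 := by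
    intro θ
    refine integral_eq_zero_of_ae ?_
    filter_upwards [Lp.coeFn_zero ℝ 2 (volume.restrict (Ioo 0 L))] with x hx
    rw [hx]
    simp
  intro φ _
  rw [aux, aux, neg_zero]

/-- A function with a weak derivative is, almost everywhere, a primitive of it. -/
theorem HasWeakDeriv.ae_eq_primitive {L : ℝ} (hL : 0 < L) {f g : L2 L} (h : HasWeakDeriv f g) :
    ∃ c : ℝ, ∀ᵐ x ∂volume.restrict (Ioo 0 L), f x = c + ∫ y in (0 : ℝ)..x, g y := by
  have hgi : IntervalIntegrable g volume 0 L :=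
    (intervalIntegrable_iff_integrableOn_Ioo_of_le hL.le).2 g.integrableOn
  have hac : AbsolutelyContinuousOnInterval (fun x => ∫ y in (0 : ℝ)..x, g y) 0 L :=
    hgi.absolutelyContinuousOnInterval_intervalIntegral left_mem_uIcc
  set F : ℝ → ℝ := fun x => ∫ y in (0 : ℝ)..x, g y with hF
  have hFi : IntegrableOn F (Ioo 0 L) := by
    have := hac.continuousOn
    rw [uIcc_of_le hL.le] at this
    exact (this.integrableOn_Icc).mono_set Ioo_subset_Icc_self
  obtain ⟨c, hc⟩ := exists_ae_eq_const_of_integral_mul_deriv_eq_zero hL (f := fun x => f x - F x)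
    (f.integrableOn.sub hFi) (by
      intro φ hφ
      have hφac : AbsolutelyContinuousOnInterval φ 0 L :=
        ContDiffOn.absolutelyContinuousOnInterval (hφ.contDiff.of_le (by simp)).contDiffOn
      have hφ0 : φ 0 = 0 := image_eq_zero_of_notMem_tsupport
        fun h' => lt_irrefl _ (hφ.tsupport_subset h').1
      have hφL : φ L = 0 := image_eq_zero_of_notMem_tsupport
        fun h' => lt_irrefl _ (hφ.tsupport_subset h').2
      have hparts := hac.integral_mul_deriv_eq_deriv_mul hφac
      rw [hφ0, hφL, mul_zero, mul_zero, sub_zero, zero_sub] at hparts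
      have hd : ∫ x in (0 : ℝ)..L, deriv F x * φ x = ∫ x in (0 : ℝ)..L, g x * φ x := by
        refine intervalIntegral.integral_congr_ae ?_
        filter_upwards [hgi.ae_hasDerivAt_integral] with x hx hxI
        rw [(hx (uIoc_subset_uIcc hxI) 0 left_mem_uIcc).deriv]
      rw [hd, intervalIntegral.integral_of_le hL.le, intervalIntegral.integral_of_le hL.le,
        integral_Ioc_eq_integral_Ioo, integral_Ioc_eq_integral_Ioo] at hparts
      have e : (fun x => (f x - F x) * _root_.deriv φ x)
          = fun x => f x * _root_.deriv φ x - F x * _root_.deriv φ x := by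
        funext x; ring
      rw [e, integral_sub (hφ.deriv.integrable_mul f.integrableOn) (hφ.deriv.integrable_mul hFi),
        h φ hφ, hparts, sub_self])
  exact ⟨c, by filter_upwards [hc] with x hx; linarith⟩

theorem HasWeakDeriv.exists_isContRep {L : ℝ} (hL : 0 < L) {f g : L2 L} (h : HasWeakDeriv f g) :
    ∃ u : ℝ → ℝ, IsContRep f u := by
  obtain ⟨c, hc⟩ := h.ae_eq_primitive hL
  have hgi : IntervalIntegrable g volume 0 L :=
    (intervalIntegrable_iff_integrableOn_Ioo_of_le hL.le).2 g.integrableOn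
  have hcont := (hgi.absolutelyContinuousOnInterval_intervalIntegral left_mem_uIcc).continuousOn
  rw [uIcc_of_le hL.le] at hcont
  exact ⟨_, continuousOn_const.add hcont, hc⟩

theorem IsContRep.pointValue_eq {L : ℝ} (hL : 0 < L) {f : L2 L} {u : ℝ → ℝ} (hu : IsContRep f u)
    {x : ℝ} (hx : x ∈ Icc 0 L) : pointValue f x = u x := by
  have hex : ∃ u : ℝ → ℝ, IsContRep f u := ⟨u, hu⟩
  rw [pointValue, dif_pos hex]
  have hv := hex.choose_spec
  refine Measure.eqOn_Icc_of_ae_eq volume hL.ne ?_ hv.1 hu.1 hx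
  rw [← restrict_Ioo_eq_restrict_Icc]
  exact hv.2.symm.trans hu.2

/-- The Sobolev space `H¹(0, L)`. -/
def H1 (L : ℝ) : Submodule ℝ (L2 L) where
  carrier := {f | ∃ g : L2 L, HasWeakDeriv f g}
  zero_mem' := ⟨0, HasWeakDeriv.zero⟩
  add_mem' := fun ⟨_, h₁⟩ ⟨_, h₂⟩ => ⟨_, h₁.add h₂⟩
  smul_mem' := fun c _ ⟨_, h⟩ => ⟨_, h.smul c⟩

theorem hasWeakDeriv_weakDeriv {L : ℝ} {f : L2 L} (hf : f ∈ H1 L) :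
    HasWeakDeriv f (weakDeriv f) := by
  obtain ⟨g, hg⟩ := hf
  rwa [hg.weakDeriv_eq]

theorem weakDeriv_add {L : ℝ} {f g : L2 L} (hf : f ∈ H1 L) (hg : g ∈ H1 L) :
    weakDeriv (f + g) = weakDeriv f + weakDeriv g :=
  ((hasWeakDeriv_weakDeriv hf).add (hasWeakDeriv_weakDeriv hg)).weakDeriv_eq

theorem weakDeriv_smul {L : ℝ} (c : ℝ) {f : L2 L} (hf : f ∈ H1 L) :
    weakDeriv (c • f) = c • weakDeriv f :=
  ((hasWeakDeriv_weakDeriv hf).smul c).weakDeriv_eq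

theorem weakDeriv_zero {L : ℝ} : weakDeriv (0 : L2 L) = 0 := HasWeakDeriv.zero.weakDeriv_eq

theorem isContRep_pointValue {L : ℝ} (hL : 0 < L) {f : L2 L} (hf : f ∈ H1 L) :
    IsContRep f (pointValue f) := by
  obtain ⟨u, hu⟩ := (hasWeakDeriv_weakDeriv hf).exists_isContRep hL
  have he : EqOn (pointValue f) u (Icc 0 L) := fun x hx => hu.pointValue_eq hL hx
  refine ⟨hu.1.congr he, ?_⟩
  filter_upwards [hu.2, ae_restrict_mem measurableSet_Ioo] with x hx hxI
  rw [hx, he (Ioo_subset_Icc_self hxI)]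

theorem pointValue_add {L : ℝ} (hL : 0 < L) {f g : L2 L} (hf : f ∈ H1 L) (hg : g ∈ H1 L)
    {x : ℝ} (hx : x ∈ Icc 0 L) : pointValue (f + g) x = pointValue f x + pointValue g x := by
  have h1 := isContRep_pointValue hL hf
  have h2 := isContRep_pointValue hL hg
  have h3 : IsContRep (f + g) (fun x => pointValue f x + pointValue g x) := by
    refine ⟨h1.1.add h2.1, ?_⟩
    filter_upwards [Lp.coeFn_add f g, h1.2, h2.2] with x a1 a2 a3
    rw [a1, Pi.add_apply, a2, a3]
  exact h3.pointValue_eq hL hx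

theorem pointValue_smul {L : ℝ} (hL : 0 < L) (c : ℝ) {f : L2 L} (hf : f ∈ H1 L)
    {x : ℝ} (hx : x ∈ Icc 0 L) : pointValue (c • f) x = c * pointValue f x := by
  have h1 := isContRep_pointValue hL hf
  have h3 : IsContRep (c • f) (fun x => c * pointValue f x) := by
    refine ⟨continuousOn_const.mul h1.1, ?_⟩
    filter_upwards [Lp.coeFn_smul c f, h1.2] with x a1 a2
    rw [a1, Pi.smul_apply, a2, smul_eq_mul]
  exact h3.pointValue_eq hL hx

theorem pointValue_zero {L : ℝ} (hL : 0 < L) {x : ℝ} (hx : x ∈ Icc 0 L) :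
    pointValue (0 : L2 L) x = 0 := by
  have := pointValue_smul hL 0 (H1 L).zero_mem hx
  simpa using this

/-- The Sobolev space `H²(0, L)`. -/
def H2 (L : ℝ) : Submodule ℝ (L2 L) where
  carrier := {f | f ∈ H1 L ∧ weakDeriv f ∈ H1 L}
  zero_mem' := ⟨(H1 L).zero_mem, by rw [weakDeriv_zero]; exact (H1 L).zero_mem⟩
  add_mem' := fun ha hb => ⟨(H1 L).add_mem ha.1 hb.1, by
    rw [weakDeriv_add ha.1 hb.1]; exact (H1 L).add_mem ha.2 hb.2⟩
  smul_mem' := fun c _ ha => ⟨(H1 L).smul_mem c ha.1, by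
    rw [weakDeriv_smul c ha.1]; exact (H1 L).smul_mem c ha.2⟩

/-- The space `H¹_*(0, L) = {f ∈ H¹(0, L) ; f(0) = 0}`. -/
def H1star (L : ℝ) [hL : Fact (0 < L)] : Submodule ℝ (L2 L) where
  carrier := {f | f ∈ H1 L ∧ pointValue f 0 = 0}
  zero_mem' := ⟨(H1 L).zero_mem, pointValue_zero hL.out (left_mem_Icc.2 hL.out.le)⟩
  add_mem' := fun ha hb => ⟨(H1 L).add_mem ha.1 hb.1, by
    rw [pointValue_add hL.out ha.1 hb.1 (left_mem_Icc.2 hL.out.le), ha.2, hb.2, add_zero]⟩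
  smul_mem' := fun c _ ha => ⟨(H1 L).smul_mem c ha.1, by
    rw [pointValue_smul hL.out c ha.1 (left_mem_Icc.2 hL.out.le), ha.2, mul_zero]⟩

theorem eq_zero_of_mem_H1star {L : ℝ} [hL : Fact (0 < L)] {f : L2 L} (hf : f ∈ H1star L)
    (h0 : weakDeriv f = 0) : f = 0 := by
  have hd := hasWeakDeriv_weakDeriv hf.1
  rw [h0] at hd
  obtain ⟨c, hc⟩ := hd.ae_eq_primitive hL.out
  have hz : ∀ᵐ y, y ∈ Ioo 0 L → (0 : L2 L) y = 0 := by
    refine (ae_restrict_iff' measurableSet_Ioo).1 ?_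
    exact Lp.coeFn_zero ℝ 2 (volume.restrict (Ioo 0 L))
  have hc' : ∀ᵐ x ∂volume.restrict (Ioo 0 L), f x = c := by
    filter_upwards [hc, ae_restrict_mem measurableSet_Ioo] with x hx hxI
    rw [hx, intervalIntegral.integral_zero_ae, add_zero]
    filter_upwards [hz] with y hy hyI
    rw [uIoc_of_le hxI.1.le] at hyI
    exact hy ⟨hyI.1, hyI.2.trans_lt hxI.2⟩
  have hrep : IsContRep f fun _ => c := ⟨continuousOn_const, hc'⟩
  have hc0 : c = 0 := by
    rw [← hf.2, hrep.pointValue_eq hL.out (left_mem_Icc.2 hL.out.le)]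
  refine Lp.ext ?_
  filter_upwards [hc', Lp.coeFn_zero ℝ 2 (volume.restrict (Ioo 0 L))] with x h1 h2
  rw [h1, h2, hc0, Pi.zero_apply]

/-- The physical constants of the laminated beam: its length `L`, and `ρ₁, ρ₂, k, b, γ`,
all positive. -/
structure Beam where
  L : ℝ
  ρ₁ : ℝ
  ρ₂ : ℝ
  k : ℝ
  b : ℝ
  γ : ℝ
  L_pos : 0 < L
  ρ₁_pos : 0 < ρ₁
  ρ₂_pos : 0 < ρ₂
  k_pos : 0 < k
  b_pos : 0 < b
  γ_pos : 0 < γ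

instance Beam.fact_L_pos (P : Beam) : Fact (0 < P.L) := ⟨P.L_pos⟩

/-- The vector space underlying `ℋ = [H¹_*(0, L) × L²(0, L)]³ × ℝ³`. Its norm is the energy norm
introduced below, not a product norm. -/
def PhaseSpace (P : Beam) : Type :=
  H1star P.L × L2 P.L × H1star P.L × L2 P.L × H1star P.L × L2 P.L × ℝ × ℝ × ℝ

namespace PhaseSpace

variable {P : Beam}

instance : AddCommGroup (PhaseSpace P) := inferInstanceAs
  (AddCommGroup (H1star P.L × L2 P.L × H1star P.L × L2 P.L × H1star P.L × L2 P.L × ℝ × ℝ × ℝ))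

instance : Module ℝ (PhaseSpace P) := inferInstanceAs
  (Module ℝ (H1star P.L × L2 P.L × H1star P.L × L2 P.L × H1star P.L × L2 P.L × ℝ × ℝ × ℝ))

/-- The vector `(w, Ψ₁, ξ, Ψ₂, s, Ψ₃, Ψ₄, Ψ₅, Ψ₆)` of `ℋ`. -/
def mk (w : H1star P.L) (Ψ₁ : L2 P.L) (ξ : H1star P.L) (Ψ₂ : L2 P.L) (s : H1star P.L)
    (Ψ₃ : L2 P.L) (Ψ₄ Ψ₅ Ψ₆ : ℝ) : PhaseSpace P := (w, Ψ₁, ξ, Ψ₂, s, Ψ₃, Ψ₄, Ψ₅, Ψ₆)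

def w (U : PhaseSpace P) : L2 P.L := (Prod.fst U).1
def Ψ₁ (U : PhaseSpace P) : L2 P.L := (Prod.snd U).1
def ξ (U : PhaseSpace P) : L2 P.L := (Prod.snd U).2.1.1
def Ψ₂ (U : PhaseSpace P) : L2 P.L := (Prod.snd U).2.2.1
def s (U : PhaseSpace P) : L2 P.L := (Prod.snd U).2.2.2.1.1
def Ψ₃ (U : PhaseSpace P) : L2 P.L := (Prod.snd U).2.2.2.2.1
def Ψ₄ (U : PhaseSpace P) : ℝ := (Prod.snd U).2.2.2.2.2.1
def Ψ₅ (U : PhaseSpace P) : ℝ := (Prod.snd U).2.2.2.2.2.2.1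
def Ψ₆ (U : PhaseSpace P) : ℝ := (Prod.snd U).2.2.2.2.2.2.2

section

variable (w : H1star P.L) (Ψ₁ : L2 P.L) (ξ : H1star P.L) (Ψ₂ : L2 P.L) (s : H1star P.L)
  (Ψ₃ : L2 P.L) (Ψ₄ Ψ₅ Ψ₆ : ℝ)

@[simp] theorem w_mk : (mk w Ψ₁ ξ Ψ₂ s Ψ₃ Ψ₄ Ψ₅ Ψ₆).w = (w : L2 P.L) := rfl
@[simp] theorem Ψ₁_mk : (mk w Ψ₁ ξ Ψ₂ s Ψ₃ Ψ₄ Ψ₅ Ψ₆).Ψ₁ = Ψ₁ := rfl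
@[simp] theorem ξ_mk : (mk w Ψ₁ ξ Ψ₂ s Ψ₃ Ψ₄ Ψ₅ Ψ₆).ξ = (ξ : L2 P.L) := rfl
@[simp] theorem Ψ₂_mk : (mk w Ψ₁ ξ Ψ₂ s Ψ₃ Ψ₄ Ψ₅ Ψ₆).Ψ₂ = Ψ₂ := rfl
@[simp] theorem s_mk : (mk w Ψ₁ ξ Ψ₂ s Ψ₃ Ψ₄ Ψ₅ Ψ₆).s = (s : L2 P.L) := rfl
@[simp] theorem Ψ₃_mk : (mk w Ψ₁ ξ Ψ₂ s Ψ₃ Ψ₄ Ψ₅ Ψ₆).Ψ₃ = Ψ₃ := rfl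
@[simp] theorem Ψ₄_mk : (mk w Ψ₁ ξ Ψ₂ s Ψ₃ Ψ₄ Ψ₅ Ψ₆).Ψ₄ = Ψ₄ := rfl
@[simp] theorem Ψ₅_mk : (mk w Ψ₁ ξ Ψ₂ s Ψ₃ Ψ₄ Ψ₅ Ψ₆).Ψ₅ = Ψ₅ := rfl
@[simp] theorem Ψ₆_mk : (mk w Ψ₁ ξ Ψ₂ s Ψ₃ Ψ₄ Ψ₅ Ψ₆).Ψ₆ = Ψ₆ := rfl

end

theorem w_mem (U : PhaseSpace P) : U.w ∈ H1star P.L := (Prod.fst U).2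
theorem ξ_mem (U : PhaseSpace P) : U.ξ ∈ H1star P.L := (Prod.snd U).2.1.2
theorem s_mem (U : PhaseSpace P) : U.s ∈ H1star P.L := (Prod.snd U).2.2.2.1.2

theorem ext' {U V : PhaseSpace P} (h1 : U.w = V.w) (h2 : U.Ψ₁ = V.Ψ₁) (h3 : U.ξ = V.ξ)
    (h4 : U.Ψ₂ = V.Ψ₂) (h5 : U.s = V.s) (h6 : U.Ψ₃ = V.Ψ₃) (h7 : U.Ψ₄ = V.Ψ₄)
    (h8 : U.Ψ₅ = V.Ψ₅) (h9 : U.Ψ₆ = V.Ψ₆) : U = V := by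
  refine Prod.ext (Subtype.ext h1) (Prod.ext h2 (Prod.ext (Subtype.ext h3) (Prod.ext h4
    (Prod.ext (Subtype.ext h5) (Prod.ext h6 (Prod.ext h7 (Prod.ext h8 h9)))))))

section

variable (U V : PhaseSpace P) (c : ℝ)

@[simp] theorem w_add : (U + V).w = U.w + V.w := rfl
@[simp] theorem Ψ₁_add : (U + V).Ψ₁ = U.Ψ₁ + V.Ψ₁ := rfl
@[simp] theorem ξ_add : (U + V).ξ = U.ξ + V.ξ := rfl
@[simp] theorem Ψ₂_add : (U + V).Ψ₂ = U.Ψ₂ + V.Ψ₂ := rfl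
@[simp] theorem s_add : (U + V).s = U.s + V.s := rfl
@[simp] theorem Ψ₃_add : (U + V).Ψ₃ = U.Ψ₃ + V.Ψ₃ := rfl
@[simp] theorem Ψ₄_add : (U + V).Ψ₄ = U.Ψ₄ + V.Ψ₄ := rfl
@[simp] theorem Ψ₅_add : (U + V).Ψ₅ = U.Ψ₅ + V.Ψ₅ := rfl
@[simp] theorem Ψ₆_add : (U + V).Ψ₆ = U.Ψ₆ + V.Ψ₆ := rfl
@[simp] theorem w_smul : (c • U).w = c • U.w := rfl
@[simp] theorem Ψ₁_smul : (c • U).Ψ₁ = c • U.Ψ₁ := rfl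
@[simp] theorem ξ_smul : (c • U).ξ = c • U.ξ := rfl
@[simp] theorem Ψ₂_smul : (c • U).Ψ₂ = c • U.Ψ₂ := rfl
@[simp] theorem s_smul : (c • U).s = c • U.s := rfl
@[simp] theorem Ψ₃_smul : (c • U).Ψ₃ = c • U.Ψ₃ := rfl
@[simp] theorem Ψ₄_smul : (c • U).Ψ₄ = c * U.Ψ₄ := rfl
@[simp] theorem Ψ₅_smul : (c • U).Ψ₅ = c * U.Ψ₅ := rfl
@[simp] theorem Ψ₆_smul : (c • U).Ψ₆ = c * U.Ψ₆ := rfl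
@[simp] theorem w_zero : (0 : PhaseSpace P).w = 0 := rfl
@[simp] theorem Ψ₁_zero : (0 : PhaseSpace P).Ψ₁ = 0 := rfl
@[simp] theorem ξ_zero : (0 : PhaseSpace P).ξ = 0 := rfl
@[simp] theorem Ψ₂_zero : (0 : PhaseSpace P).Ψ₂ = 0 := rfl
@[simp] theorem s_zero : (0 : PhaseSpace P).s = 0 := rfl
@[simp] theorem Ψ₃_zero : (0 : PhaseSpace P).Ψ₃ = 0 := rfl
@[simp] theorem Ψ₄_zero : (0 : PhaseSpace P).Ψ₄ = 0 := rfl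
@[simp] theorem Ψ₅_zero : (0 : PhaseSpace P).Ψ₅ = 0 := rfl
@[simp] theorem Ψ₆_zero : (0 : PhaseSpace P).Ψ₆ = 0 := rfl

end

/-- The shear strain `w_x + ξ + s`. -/
def shear (U : PhaseSpace P) : L2 P.L := weakDeriv U.w + U.ξ + U.s

theorem shear_add (U V : PhaseSpace P) : (U + V).shear = U.shear + V.shear := by
  simp only [shear, w_add, ξ_add, s_add, weakDeriv_add U.w_mem.1 V.w_mem.1]
  abel

theorem shear_smul (c : ℝ) (U : PhaseSpace P) : (c • U).shear = c • U.shear := by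
  simp only [shear, w_smul, ξ_smul, s_smul, weakDeriv_smul c U.w_mem.1, smul_add]

/-- The inner product of `ℋ`. -/
def energyInner (U V : PhaseSpace P) : ℝ :=
  3 * P.ρ₁ * inner ℝ U.Ψ₁ V.Ψ₁ + 3 * P.ρ₂ * inner ℝ U.Ψ₂ V.Ψ₂ + P.ρ₂ * inner ℝ U.Ψ₃ V.Ψ₃
    + 3 * P.b * inner ℝ (weakDeriv U.ξ) (weakDeriv V.ξ)
    + P.b * inner ℝ (weakDeriv U.s) (weakDeriv V.s)
    + P.γ * inner ℝ U.s V.s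
    + 3 * P.k * inner ℝ U.shear V.shear
    + 3 * P.k * (U.Ψ₄ * V.Ψ₄) + 3 * P.b * (U.Ψ₅ * V.Ψ₅) + P.b * (U.Ψ₆ * V.Ψ₆)

theorem energyInner_self (U : PhaseSpace P) :
    energyInner U U = 3 * P.ρ₁ * ‖U.Ψ₁‖ ^ 2 + 3 * P.ρ₂ * ‖U.Ψ₂‖ ^ 2 + P.ρ₂ * ‖U.Ψ₃‖ ^ 2
      + 3 * P.b * ‖weakDeriv U.ξ‖ ^ 2 + P.b * ‖weakDeriv U.s‖ ^ 2 + P.γ * ‖U.s‖ ^ 2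
      + 3 * P.k * ‖U.shear‖ ^ 2
      + 3 * P.k * U.Ψ₄ ^ 2 + 3 * P.b * U.Ψ₅ ^ 2 + P.b * U.Ψ₆ ^ 2 := by
  simp only [energyInner, real_inner_self_eq_norm_sq]
  ring

@[reducible] def innerCore (P : Beam) : InnerProductSpace.Core ℝ (PhaseSpace P) where
  inner := energyInner
  conj_inner_symm U V := by
    simp only [energyInner, conj_trivial, real_inner_comm, mul_comm]
  re_inner_nonneg U := by
    have := P.ρ₁_pos; have := P.ρ₂_pos; have := P.k_pos; have := P.b_pos; have := P.γ_pos
    change 0 ≤ energyInner U U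
    rw [energyInner_self]
    positivity
  add_left U V W := by
    simp only [energyInner, Ψ₁_add, Ψ₂_add, Ψ₃_add, Ψ₄_add, Ψ₅_add, Ψ₆_add, ξ_add, s_add, shear_add,
      weakDeriv_add U.ξ_mem.1 V.ξ_mem.1, weakDeriv_add U.s_mem.1 V.s_mem.1, inner_add_left]
    ring
  smul_left U V c := by
    simp only [energyInner, Ψ₁_smul, Ψ₂_smul, Ψ₃_smul, Ψ₄_smul, Ψ₅_smul, Ψ₆_smul, ξ_smul, s_smul,
      shear_smul, weakDeriv_smul c U.ξ_mem.1, weakDeriv_smul c U.s_mem.1, real_inner_smul_left,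
      conj_trivial]
    ring
  definite U hU := by
    have := P.ρ₁_pos; have := P.ρ₂_pos; have := P.k_pos; have := P.b_pos; have := P.γ_pos
    change energyInner U U = 0 at hU
    rw [energyInner_self] at hU
    have p1 : 0 ≤ 3 * P.ρ₁ * ‖U.Ψ₁‖ ^ 2 := by positivity
    have p2 : 0 ≤ 3 * P.ρ₂ * ‖U.Ψ₂‖ ^ 2 := by positivity
    have p3 : 0 ≤ P.ρ₂ * ‖U.Ψ₃‖ ^ 2 := by positivity
    have p4 : 0 ≤ 3 * P.b * ‖weakDeriv U.ξ‖ ^ 2 := by positivity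
    have p5 : 0 ≤ P.b * ‖weakDeriv U.s‖ ^ 2 := by positivity
    have p6 : 0 ≤ P.γ * ‖U.s‖ ^ 2 := by positivity
    have p7 : 0 ≤ 3 * P.k * ‖U.shear‖ ^ 2 := by positivity
    have p8 : 0 ≤ 3 * P.k * U.Ψ₄ ^ 2 := by positivity
    have p9 : 0 ≤ 3 * P.b * U.Ψ₅ ^ 2 := by positivity
    have p10 : 0 ≤ P.b * U.Ψ₆ ^ 2 := by positivity
    have z : ∀ a x : ℝ, 0 < a → a * x ^ 2 = 0 → x = 0 := fun a x ha h => by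
      simpa [ha.ne'] using h
    have q1 := norm_eq_zero.1 (z _ _ (by positivity) (by linarith : 3 * P.ρ₁ * ‖U.Ψ₁‖ ^ 2 = 0))
    have q2 := norm_eq_zero.1 (z _ _ (by positivity) (by linarith : 3 * P.ρ₂ * ‖U.Ψ₂‖ ^ 2 = 0))
    have q3 := norm_eq_zero.1 (z _ _ (by positivity) (by linarith : P.ρ₂ * ‖U.Ψ₃‖ ^ 2 = 0))
    have q4 := norm_eq_zero.1
      (z _ _ (by positivity) (by linarith : 3 * P.b * ‖weakDeriv U.ξ‖ ^ 2 = 0))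
    have q6 := norm_eq_zero.1 (z _ _ (by positivity) (by linarith : P.γ * ‖U.s‖ ^ 2 = 0))
    have q7 := norm_eq_zero.1 (z _ _ (by positivity) (by linarith : 3 * P.k * ‖U.shear‖ ^ 2 = 0))
    have q8 := z _ _ (by positivity) (by linarith : 3 * P.k * U.Ψ₄ ^ 2 = 0)
    have q9 := z _ _ (by positivity) (by linarith : 3 * P.b * U.Ψ₅ ^ 2 = 0)
    have q10 := z _ _ (by positivity) (by linarith : P.b * U.Ψ₆ ^ 2 = 0)
    have hξ : U.ξ = 0 := eq_zero_of_mem_H1star U.ξ_mem q4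
    have hw : U.w = 0 := by
      refine eq_zero_of_mem_H1star U.w_mem ?_
      rw [shear, hξ, q6, add_zero, add_zero] at q7
      exact q7
    exact ext' hw q1 hξ q2 q6 q3 q8 q9 q10

instance : NormedAddCommGroup (PhaseSpace P) := (innerCore P).toNormedAddCommGroup

instance : InnerProductSpace ℝ (PhaseSpace P) := InnerProductSpace.ofCore (innerCore P).toCore

end PhaseSpace

/-- The domain `D(𝒜)`. -/
def domainA (P : Beam) : Submodule ℝ (PhaseSpace P) where
  carrier := {U | (U.w ∈ H2 P.L ∧ U.ξ ∈ H2 P.L ∧ U.s ∈ H2 P.L) ∧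
    (U.Ψ₁ ∈ H1star P.L ∧ U.Ψ₂ ∈ H1star P.L ∧ U.Ψ₃ ∈ H1star P.L) ∧
    U.Ψ₄ = pointValue U.Ψ₁ P.L ∧ U.Ψ₅ = pointValue U.Ψ₂ P.L ∧ U.Ψ₆ = pointValue U.Ψ₃ P.L}
  zero_mem' := by
    have hL : P.L ∈ Icc 0 P.L := right_mem_Icc.2 P.L_pos.le
    refine ⟨⟨(H2 _).zero_mem, (H2 _).zero_mem, (H2 _).zero_mem⟩,
      ⟨(H1star _).zero_mem, (H1star _).zero_mem, (H1star _).zero_mem⟩, ?_, ?_, ?_⟩ <;>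
    simp [pointValue_zero P.L_pos hL]
  add_mem' := by
    have hL : P.L ∈ Icc 0 P.L := right_mem_Icc.2 P.L_pos.le
    rintro U V ⟨⟨a1, a2, a3⟩, ⟨a4, a5, a6⟩, a7, a8, a9⟩ ⟨⟨b1, b2, b3⟩, ⟨b4, b5, b6⟩, b7, b8, b9⟩
    refine ⟨⟨(H2 _).add_mem a1 b1, (H2 _).add_mem a2 b2, (H2 _).add_mem a3 b3⟩,
      ⟨(H1star _).add_mem a4 b4, (H1star _).add_mem a5 b5, (H1star _).add_mem a6 b6⟩, ?_, ?_, ?_⟩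
    · simp [pointValue_add P.L_pos a4.1 b4.1 hL, a7, b7]
    · simp [pointValue_add P.L_pos a5.1 b5.1 hL, a8, b8]
    · simp [pointValue_add P.L_pos a6.1 b6.1 hL, a9, b9]
  smul_mem' := by
    have hL : P.L ∈ Icc 0 P.L := right_mem_Icc.2 P.L_pos.le
    rintro c U ⟨⟨a1, a2, a3⟩, ⟨a4, a5, a6⟩, a7, a8, a9⟩
    refine ⟨⟨(H2 _).smul_mem c a1, (H2 _).smul_mem c a2, (H2 _).smul_mem c a3⟩,
      ⟨(H1star _).smul_mem c a4, (H1star _).smul_mem c a5, (H1star _).smul_mem c a6⟩, ?_, ?_, ?_⟩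
    · simp [pointValue_smul P.L_pos c a4.1 hL, a7]
    · simp [pointValue_smul P.L_pos c a5.1 hL, a8]
    · simp [pointValue_smul P.L_pos c a6.1 hL, a9]

theorem shear_mem_H1 {P : Beam} {U : PhaseSpace P} (hU : U ∈ domainA P) : U.shear ∈ H1 P.L :=
  (H1 _).add_mem ((H1 _).add_mem hU.1.1.2 U.ξ_mem.1) U.s_mem.1

/-- The vector `𝒜 U` for `U ∈ D(𝒜)`. -/
def applyA {P : Beam} (U : PhaseSpace P) (hU : U ∈ domainA P) : PhaseSpace P :=
  PhaseSpace.mk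
    ⟨U.Ψ₁, hU.2.1.1⟩
    ((1 / P.ρ₁) • (P.k • weakDeriv U.shear))
    ⟨U.Ψ₂, hU.2.1.2.1⟩
    ((1 / P.ρ₂) • (P.b • weakDeriv (weakDeriv U.ξ) - P.k • U.shear))
    ⟨U.Ψ₃, hU.2.1.2.2⟩
    ((1 / P.ρ₂) • (P.b • weakDeriv (weakDeriv U.s) - (3 * P.k) • U.shear - P.γ • U.s))
    (-(pointValue (weakDeriv U.w) P.L + pointValue U.ξ P.L + pointValue U.s P.L))
    (-pointValue (weakDeriv U.ξ) P.L)
    (-pointValue (weakDeriv U.s) P.L)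

theorem applyA_add {P : Beam} {U V : PhaseSpace P} (hU : U ∈ domainA P) (hV : V ∈ domainA P) :
    applyA (U + V) ((domainA P).add_mem hU hV) = applyA U hU + applyA V hV := by
  have hL : P.L ∈ Icc 0 P.L := right_mem_Icc.2 P.L_pos.le
  have d1 := weakDeriv_add U.w_mem.1 V.w_mem.1
  have d2 := weakDeriv_add U.ξ_mem.1 V.ξ_mem.1
  have d3 := weakDeriv_add U.s_mem.1 V.s_mem.1
  have d4 := weakDeriv_add hU.1.2.1.2 hV.1.2.1.2
  have d5 := weakDeriv_add hU.1.2.2.2 hV.1.2.2.2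
  have d6 := weakDeriv_add (shear_mem_H1 hU) (shear_mem_H1 hV)
  have v1 := pointValue_add P.L_pos hU.1.1.2 hV.1.1.2 hL
  have v2 := pointValue_add P.L_pos U.ξ_mem.1 V.ξ_mem.1 hL
  have v3 := pointValue_add P.L_pos U.s_mem.1 V.s_mem.1 hL
  have v4 := pointValue_add P.L_pos hU.1.2.1.2 hV.1.2.1.2 hL
  have v5 := pointValue_add P.L_pos hU.1.2.2.2 hV.1.2.2.2 hL
  apply PhaseSpace.ext' <;> simp only [applyA, PhaseSpace.w_mk, PhaseSpace.Ψ₁_mk, PhaseSpace.ξ_mk,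
    PhaseSpace.Ψ₂_mk, PhaseSpace.s_mk, PhaseSpace.Ψ₃_mk, PhaseSpace.Ψ₄_mk, PhaseSpace.Ψ₅_mk,
    PhaseSpace.Ψ₆_mk, PhaseSpace.w_add, PhaseSpace.Ψ₁_add, PhaseSpace.ξ_add, PhaseSpace.Ψ₂_add,
    PhaseSpace.s_add, PhaseSpace.Ψ₃_add, PhaseSpace.Ψ₄_add, PhaseSpace.Ψ₅_add, PhaseSpace.Ψ₆_add,
    PhaseSpace.shear_add, d1, d2, d3, d4, d5, d6, v1, v2, v3, v4, v5] <;> module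

theorem applyA_smul {P : Beam} (c : ℝ) {U : PhaseSpace P} (hU : U ∈ domainA P) :
    applyA (c • U) ((domainA P).smul_mem c hU) = c • applyA U hU := by
  have hL : P.L ∈ Icc 0 P.L := right_mem_Icc.2 P.L_pos.le
  have d1 := weakDeriv_smul c U.w_mem.1
  have d2 := weakDeriv_smul c U.ξ_mem.1
  have d3 := weakDeriv_smul c U.s_mem.1
  have d4 := weakDeriv_smul c hU.1.2.1.2
  have d5 := weakDeriv_smul c hU.1.2.2.2
  have d6 := weakDeriv_smul c (shear_mem_H1 hU)
  have v1 := pointValue_smul P.L_pos c hU.1.1.2 hL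
  have v2 := pointValue_smul P.L_pos c U.ξ_mem.1 hL
  have v3 := pointValue_smul P.L_pos c U.s_mem.1 hL
  have v4 := pointValue_smul P.L_pos c hU.1.2.1.2 hL
  have v5 := pointValue_smul P.L_pos c hU.1.2.2.2 hL
  apply PhaseSpace.ext' <;> simp only [applyA, PhaseSpace.w_mk, PhaseSpace.Ψ₁_mk, PhaseSpace.ξ_mk,
    PhaseSpace.Ψ₂_mk, PhaseSpace.s_mk, PhaseSpace.Ψ₃_mk, PhaseSpace.Ψ₄_mk, PhaseSpace.Ψ₅_mk,
    PhaseSpace.Ψ₆_mk, PhaseSpace.w_smul, PhaseSpace.Ψ₁_smul, PhaseSpace.ξ_smul, PhaseSpace.Ψ₂_smul,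
    PhaseSpace.s_smul, PhaseSpace.Ψ₃_smul, PhaseSpace.Ψ₄_smul, PhaseSpace.Ψ₅_smul,
    PhaseSpace.Ψ₆_smul, PhaseSpace.shear_smul, d1, d2, d3, d4, d5, d6, v1, v2, v3, v4, v5] <;>
    first | module | ring

/-- The unbounded operator `𝒜 : D(𝒜) ⊆ ℋ → ℋ`. -/
def operatorA (P : Beam) : PhaseSpace P →ₗ.[ℝ] PhaseSpace P where
  domain := domainA P
  toFun :=
    { toFun := fun U => applyA U.1 U.2
      map_add' := fun U V => applyA_add U.2 V.2
      map_smul' := fun c U => applyA_smul c U.2 }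

/-- `U : [0, ∞) → D(𝒜)` is a solution of `U_t = 𝒜 U`, `U(0) = U₀`, in the class
`C([0, ∞); D(𝒜)) ∩ C¹([0, ∞); ℋ)`. The domain `D(𝒜)` carries its graph norm `‖U‖ + ‖𝒜 U‖`, so that
continuity into `D(𝒜)` is continuity of `t ↦ (U(t), 𝒜 U(t))` into `ℋ × ℋ`; derivatives at `t = 0`
are one-sided. -/
structure IsSolution (P : Beam) (U₀ : (operatorA P).domain)
    (U : NNReal → (operatorA P).domain) : Prop where
  continuous_graph : Continuous fun t : NNReal => ((U t : PhaseSpace P), operatorA P (U t))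
  contDiffOn : ContDiffOn ℝ 1 (fun t : ℝ => (U t.toNNReal : PhaseSpace P)) (Ici 0)
  hasDerivWithinAt : ∀ t : NNReal, HasDerivWithinAt (fun τ : ℝ => (U τ.toNNReal : PhaseSpace P))
    (operatorA P (U t)) (Ici 0) t
  initial : U 0 = U₀

end

/-! The energy inner product is chosen so that `operatorA P` is skew: integrating by parts the three
stresses (shear, `ξ_x`, `s_x`) against their velocities leaves only terms at `L`, and the components
`Ψ₄`, `Ψ₅`, `Ψ₆` cancel them (`inner_operatorA_self`). Along any solution `‖U‖²` therefore has
derivative `2⟨𝒜U, U⟩ = 0`. This is conservation of the norm and, applied to a difference of two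
solutions, uniqueness.

Existence is Stone's theorem for a surjective skew operator `A` on a real Hilbert space. Such an `A`
is injective, and its inverse `T` is skew and everywhere defined, hence bounded. With `ε n → 0`, the
bounded skew operators `-T (ε n - T²)⁻¹` commute with one another and converge to `T⁻¹` on the range
of `T`, which is dense. Their exponentials are isometries and converge strongly, locally uniformly
in time, to some `v` with `v 0 = y` and `(T v)' = v` (`exists_hasDerivAt_of_skew`). For `y = A u₀`
the curve `u = T v` solves `u' = A u`, and `A u = v` is continuous, which gives continuity in the
graph norm.

For the beam it remains to prove that the energy space is complete and that `𝒜` is surjective. Both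
are easy in the strain variables shear, `ξ_x`, `s_x`: they determine `w`, `ξ`, `s` by integration
from `0`, and in them `𝒜U = F` is a triangular system of first order equations with data at `L`
(`operatorA_surjective`). -/

noncomputable section

/-! ### Groups generated by skew operators on a real Hilbert space -/

section SkewGroup

variable {H : Type*} [NormedAddCommGroup H] [InnerProductSpace ℝ H]

theorem inner_eq_neg_of_inner_self_eq_zero {C : H →ₗ[ℝ] H} (hC : ∀ x, inner ℝ (C x) x = 0)
    (x y : H) : inner ℝ (C x) y = -inner ℝ x (C y) := by
  have h := hC (x + y)
  rw [map_add, inner_add_left, inner_add_right, inner_add_right, hC, hC] at h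
  rw [real_inner_comm (C y) x]
  linarith

/-- If `A u = 0` and `u = A w`, then `0 = ⟨A (u + w), u + w⟩ = ⟨u, u⟩ + ⟨A w, w⟩ = ‖u‖²`. -/
theorem LinearPMap.injective_of_skew_of_surjective {A : H →ₗ.[ℝ] H}
    (hA : ∀ u : A.domain, inner ℝ (A u) (u : H) = 0) (hs : Function.Surjective A) :
    Function.Injective A.toFun := by
  rw [injective_iff_map_eq_zero]
  intro u hu
  obtain ⟨w, hw⟩ := hs u
  have h := hA (u + w)
  have hu' : A u = 0 := hu
  rw [LinearPMap.map_add, hu', zero_add, Submodule.coe_add, inner_add_right, hA w, add_zero,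
    hw] at h
  exact Subtype.ext (inner_self_eq_zero.1 h)

/-- The derivative of `‖u‖²` is `2⟨u, A u⟩ = 0`. No generation result is needed, so this covers
every solution as well as the difference of two. -/
theorem LinearPMap.norm_eq_of_hasDerivWithinAt_of_skew {A : H →ₗ.[ℝ] H}
    (hA : ∀ u : A.domain, inner ℝ (A u) (u : H) = 0) {u : NNReal → A.domain}
    (hu : ∀ t : NNReal, HasDerivWithinAt (fun τ : ℝ => (u τ.toNNReal : H)) (A (u t)) (Ici 0) t)
    (t : NNReal) : ‖(u t : H)‖ = ‖(u 0 : H)‖ := by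
  have hd : ∀ τ ∈ Ici (0 : ℝ), HasDerivWithinAt (fun τ : ℝ => ‖(u τ.toNNReal : H)‖ ^ 2) 0
      (Ici 0) τ := by
    intro τ hτ
    have h := (hu τ.toNNReal).norm_sq
    rw [Real.coe_toNNReal τ hτ, real_inner_comm, hA, mul_zero] at h
    exact h
  have h := Convex.norm_image_sub_le_of_norm_hasDerivWithin_le hd (C := 0) (by simp)
    (convex_Ici 0) (mem_Ici.2 le_rfl) (mem_Ici.2 t.2)
  rw [zero_mul, norm_le_zero_iff, sub_eq_zero] at h
  simp only [NNReal.val_eq_coe, Real.toNNReal_coe, Real.toNNReal_zero] at h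
  exact (pow_left_inj₀ (norm_nonneg _) (norm_nonneg _) two_ne_zero).1 h

variable [CompleteSpace H]

theorem hasDerivAt_exp_smul_apply (C : H →L[ℝ] H) (x : H) (t : ℝ) :
    HasDerivAt (fun t : ℝ => NormedSpace.exp (t • C) x) (NormedSpace.exp (t • C) (C x)) t :=
  (ContinuousLinearMap.apply ℝ H x).hasFDerivAt.comp_hasDerivAt t (hasDerivAt_exp_smul_const C t)

theorem norm_exp_smul_apply {C : H →L[ℝ] H} (hC : ∀ x, inner ℝ (C x) x = 0) (t : ℝ) (x : H) :
    ‖NormedSpace.exp (t • C) x‖ = ‖x‖ := by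
  have hd : ∀ t : ℝ, HasDerivAt (fun t : ℝ => ‖NormedSpace.exp (t • C) x‖ ^ 2) 0 t := by
    intro t
    -- The form of the derivative with `C` to the left of the exponential, so that skewness applies
    -- at the vector `exp (t • C) x`.
    have h := ((ContinuousLinearMap.apply ℝ H x).hasFDerivAt.comp_hasDerivAt t
      (hasDerivAt_exp_smul_const' C t)).norm_sq
    have h0 : inner ℝ (NormedSpace.exp (t • C) x) ((C * NormedSpace.exp (t • C)) x) = 0 := by
      rw [real_inner_comm]
      exact hC _
    exact h.congr_deriv (by simpa using h0)
  have h := is_const_of_deriv_eq_zero (fun t => (hd t).differentiableAt)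
    (fun t => (hd t).deriv) t 0
  simp only [zero_smul, NormedSpace.exp_zero, one_apply_eq_self] at h
  exact (pow_left_inj₀ (norm_nonneg _) (norm_nonneg _) two_ne_zero).1 h

/-- The velocity `exp (t • C) (C x)` has constant norm `‖C x‖`, so the mean value inequality
applies. -/
theorem norm_exp_smul_apply_sub_le {C : H →L[ℝ] H} (hC : ∀ x, inner ℝ (C x) x = 0) (t : ℝ)
    (x : H) : ‖NormedSpace.exp (t • C) x - x‖ ≤ |t| * ‖C x‖ := by
  have h := Convex.norm_image_sub_le_of_norm_hasDerivWithin_le (s := univ) (x := (0 : ℝ)) (y := t)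
    (fun t _ => (hasDerivAt_exp_smul_apply C x t).hasDerivWithinAt)
    (fun t _ => (norm_exp_smul_apply hC t (C x)).le) convex_univ (mem_univ _) (mem_univ _)
  simpa [mul_comm] using h

/-- By commutation `exp (tA) = exp (tB) exp (t(A - B))`; the factor `exp (tB)` is an isometry and `A
- B` is again skew. -/
theorem norm_exp_smul_apply_sub_exp_smul_apply_le {A B : H →L[ℝ] H}
    (hA : ∀ x, inner ℝ (A x) x = 0) (hB : ∀ x, inner ℝ (B x) x = 0) (hAB : Commute A B)
    (t : ℝ) (x : H) :
    ‖NormedSpace.exp (t • A) x - NormedSpace.exp (t • B) x‖ ≤ |t| * ‖A x - B x‖ := by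
  have hC : ∀ x, inner ℝ ((A - B) x) x = 0 := fun x => by
    rw [sub_apply, inner_sub_left, hA, hB, sub_zero]
  let _ : NormedAlgebra ℚ (H →L[ℝ] H) := NormedAlgebra.restrictScalars ℚ ℝ _
  have he : NormedSpace.exp (t • A) = NormedSpace.exp (t • B) * NormedSpace.exp (t • (A - B)) := by
    rw [← NormedSpace.exp_add_of_commute, smul_sub, add_sub_cancel]
    exact ((hAB.symm.sub_right (Commute.refl B)).smul_left t).smul_right t
  rw [he, mul_apply_eq_comp, ← map_sub, norm_exp_smul_apply hB]
  exact norm_exp_smul_apply_sub_le hC t x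

/-- Strong limits of the isometry groups generated by commuting bounded skew operators. -/
theorem exists_tendstoUniformlyOn_exp_smul {A : ℕ → H →L[ℝ] H}
    (hA : ∀ n x, inner ℝ (A n x) x = 0) (hc : ∀ m n, Commute (A m) (A n)) {D : Set H}
    (hD : Dense D) (hlim : ∀ x ∈ D, CauchySeq fun n => A n x) (y : H) :
    ∃ S : ℝ → H, ∀ R : ℝ,
      TendstoUniformlyOn (fun n t => NormedSpace.exp (t • A n) y) S Filter.atTop (Icc (-R) R) := by
  have hC : ∀ R : ℝ, UniformCauchySeqOn (fun n t => NormedSpace.exp (t • A n) y) Filter.atTop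
      (Icc (-R) R) := by
    intro R
    rw [Metric.uniformCauchySeqOn_iff]
    intro ε hε
    -- Replacing `y` by `x ∈ D` costs less than `ε / 3` under each isometry. The last third bounds
    -- `|t| * ‖A m x - A n x‖`, where `|t| ≤ |R| + 1`; the `+ 1` keeps the divisor positive.
    obtain ⟨x, hxD, hx⟩ := Metric.dense_iff.1 hD y (ε / 3) (by positivity)
    rw [Metric.mem_ball, dist_comm, dist_eq_norm] at hxD
    obtain ⟨N, hN⟩ := Metric.cauchySeq_iff.1 (hlim x hx) (ε / 3 / (|R| + 1)) (by positivity)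
    refine ⟨N, fun m hm n hn t ht => ?_⟩
    have h1 := norm_exp_smul_apply (hA m) t (y - x)
    have h2 := norm_exp_smul_apply (hA n) t (y - x)
    have h3 := norm_exp_smul_apply_sub_exp_smul_apply_le (hA m) (hA n) (hc m n) t x
    have h4 := hN m hm n hn
    rw [dist_eq_norm, lt_div_iff₀ (by positivity)] at h4
    have h5 : |t| ≤ |R| + 1 := by
      have := abs_le.2 ht
      have := le_abs_self R
      linarith
    have h6 : |t| * ‖A m x - A n x‖ ≤ (|R| + 1) * ‖A m x - A n x‖ := by gcongr
    have e : NormedSpace.exp (t • A m) y - NormedSpace.exp (t • A n) y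
        = NormedSpace.exp (t • A m) (y - x)
          + (NormedSpace.exp (t • A m) x - NormedSpace.exp (t • A n) x)
          - NormedSpace.exp (t • A n) (y - x) := by
      rw [map_sub, map_sub]; abel
    rw [dist_eq_norm, e]
    refine (norm_sub_le _ _).trans_lt ?_
    have := norm_add_le (NormedSpace.exp (t • A m) (y - x))
      (NormedSpace.exp (t • A m) x - NormedSpace.exp (t • A n) x)
    linarith
  have hex : ∀ t : ℝ, ∃ z, Filter.Tendsto (fun n => NormedSpace.exp (t • A n) y) Filter.atTop
      (𝓝 z) := fun t =>
    cauchySeq_tendsto_of_complete ((hC |t|).cauchySeq ⟨neg_abs_le t, le_abs_self t⟩)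
  choose S hS using hex
  exact ⟨S, fun R => (hC R).tendstoUniformlyOn_of_tendsto fun t _ => hS t⟩

/-- A vector `x` orthogonal to the range is orthogonal to `T (T x)`, and `⟨T (T x), x⟩ = -‖T x‖²`;
hence `T x = 0`. -/
theorem denseRange_of_inner_self_eq_zero {T : H →L[ℝ] H} (hT : ∀ x, inner ℝ (T x) x = 0)
    (hinj : ∀ x, T x = 0 → x = 0) : DenseRange T := by
  have h : (LinearMap.range (T : H →ₗ[ℝ] H)).topologicalClosure = ⊤ := by
    rw [Submodule.topologicalClosure_eq_top_iff, Submodule.eq_bot_iff]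
    intro x hx
    refine hinj x ?_
    have h1 := (Submodule.mem_orthogonal _ _).1 hx (T (T x)) ⟨T x, rfl⟩
    have h2 := inner_eq_neg_of_inner_self_eq_zero (C := (T : H →ₗ[ℝ] H)) hT (T x) x
    simp only [ContinuousLinearMap.coe_coe] at h2
    rw [h1, zero_eq_neg] at h2
    exact inner_self_eq_zero.1 h2
  intro x
  have hx : x ∈ (LinearMap.range (T : H →ₗ[ℝ] H)).topologicalClosure := h ▸ Submodule.mem_top
  rw [← SetLike.mem_coe, Submodule.topologicalClosure_coe] at hx
  exact closure_mono (by rintro _ ⟨z, rfl⟩; exact ⟨z, rfl⟩) hx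

/-- Bounded skew approximations of the inverse of an injective skew operator. -/
theorem exists_skew_approximation {T : H →L[ℝ] H} (hT : ∀ x, inner ℝ (T x) x = 0)
    (hinj : ∀ x, T x = 0 → x = 0) :
    ∃ A : ℕ → H →L[ℝ] H, (∀ n x, inner ℝ (A n x) x = 0) ∧ (∀ m n, Commute (A m) (A n)) ∧
      (∀ n, Commute T (A n)) ∧
      ∀ y, Filter.Tendsto (fun n => A n (T y)) Filter.atTop (𝓝 y) := by
  have hsk : ∀ x y, inner ℝ (T x) y = -inner ℝ x (T y) :=
    inner_eq_neg_of_inner_self_eq_zero (C := (T : H →ₗ[ℝ] H)) hT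
  let ε : ℕ → ℝ := fun n => 1 / ((n : ℝ) + 1)
  have hε : ∀ n, 0 < ε n := fun n => by positivity
  -- Since `-T²` is nonnegative, `M n ≥ ε n` is invertible. The operator `-T (M n)⁻¹` regularises
  -- `-T (-T²)⁻¹ = T⁻¹`.
  let M : ℕ → H →L[ℝ] H := fun n => ε n • 1 - T * T
  let K : ℕ → H →L[ℝ] H := fun n => Ring.inverse (M n)
  have hMi : ∀ n z, inner ℝ (M n z) z = ε n * ‖z‖ ^ 2 + ‖T z‖ ^ 2 := by
    intro n z
    simp only [M, sub_apply, smul_apply,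
      one_apply_eq_self, mul_apply_eq_comp, inner_sub_left, hsk (T z) z,
      real_inner_smul_left, real_inner_self_eq_norm_sq]
    ring
  have hu : ∀ n, IsUnit (M n) := by
    intro n
    refine ContinuousLinearMap.isUnit_of_forall_le_norm_inner_map (M n) (c := ⟨ε n, (hε n).le⟩)
      (hε n) fun x => ?_
    rw [hMi]
    refine le_trans ?_ (le_abs_self _)
    change ‖x‖ ^ 2 * ε n ≤ _
    nlinarith [sq_nonneg ‖T x‖]
  have hMK : ∀ n y, M n (K n y) = y := fun n y =>
    congrArg (fun F : H →L[ℝ] H => F y) (Ring.mul_inverse_cancel _ (hu n))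
  have hTM : ∀ n, Commute T (M n) := fun n =>
    ((Commute.one_right T).smul_right (ε n)).sub_right ((Commute.refl T).mul_right (Commute.refl T))
  have hMM : ∀ m n, Commute (M m) (M n) := fun m n =>
    ((Commute.one_left (M n)).smul_left (ε m)).sub_left ((hTM n).mul_left (hTM n))
  have hTK : ∀ n, Commute T (K n) := by
    intro n
    obtain ⟨u, hu⟩ := hu n
    have : Commute T (u : H →L[ℝ] H) := hu ▸ hTM n
    simpa [K, ← hu, Ring.inverse_unit] using this.units_inv_right
  have hKK : ∀ m n, Commute (K m) (K n) := fun m n => (hMM m n).ringInverse_ringInverse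
  -- Pairing `M n (K n y) = y` with `K n y` bounds `ε n • K n` by `1`. On the range of `T` the same
  -- pairing gains a factor `√(ε n)` (`hb'`), because one `T` can be moved across and absorbed by
  -- `‖T (K n (T x))‖²`. Density then gives `ε n • K n → 0` strongly.
  have hb : ∀ n y, ‖ε n • K n y‖ ≤ ‖y‖ := by
    intro n y
    have h1 := hMi n (K n y)
    rw [hMK] at h1
    have h2 := real_inner_le_norm y (K n y)
    rw [norm_smul, Real.norm_of_nonneg (hε n).le]
    rcases (norm_nonneg (K n y)).eq_or_lt with h0 | h0
    · rw [← h0, mul_zero]; exact norm_nonneg _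
    · refine le_of_mul_le_mul_right ?_ h0
      nlinarith [sq_nonneg ‖T (K n y)‖]
  have hb' : ∀ n x, ‖ε n • K n (T x)‖ ≤ √(ε n) * ‖x‖ := by
    intro n x
    have h1 := hMi n (K n (T x))
    rw [hMK, hsk] at h1
    have h2 := (neg_le_abs _).trans (abs_real_inner_le_norm x (T (K n (T x))))
    have h3 : ε n * ‖K n (T x)‖ ^ 2 ≤ ‖x‖ ^ 2 := by
      nlinarith [sq_nonneg (‖x‖ - ‖T (K n (T x))‖), sq_nonneg ‖x‖, sq_nonneg ‖T (K n (T x))‖]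
    rw [norm_smul, Real.norm_of_nonneg (hε n).le]
    refine abs_le_of_sq_le_sq' ?_ (by positivity) |>.2
    rw [mul_pow, mul_pow, Real.sq_sqrt (hε n).le]
    nlinarith [hε n]
  have hε0 : Filter.Tendsto ε Filter.atTop (𝓝 0) := tendsto_one_div_add_atTop_nhds_zero_nat
  have hK0 : ∀ y, Filter.Tendsto (fun n => ε n • K n y) Filter.atTop (𝓝 0) := by
    intro y
    rw [Metric.tendsto_atTop]
    intro δ hδ
    obtain ⟨_, hx, x, rfl⟩ := Metric.dense_iff.1 (denseRange_of_inner_self_eq_zero hT hinj) y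
      (δ / 2) (by positivity)
    rw [Metric.mem_ball, dist_comm, dist_eq_norm] at hx
    have hl : Filter.Tendsto (fun n => √(ε n) * ‖x‖) Filter.atTop (𝓝 0) := by
      simpa using hε0.sqrt.mul_const ‖x‖
    obtain ⟨N, hN⟩ := Filter.eventually_atTop.1 (hl.eventually_lt_const (half_pos hδ))
    refine ⟨N, fun n hn => ?_⟩
    have h1 := hb n (y - T x)
    have h2 := hb' n x
    have h3 := hN n hn
    rw [dist_zero_right]
    have e : ε n • K n y = ε n • K n (y - T x) + ε n • K n (T x) := by
      rw [← smul_add, ← map_add, sub_add_cancel]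
    rw [e]
    refine (norm_add_le _ _).trans_lt ?_
    linarith
  refine ⟨fun n => -(T * K n), fun n x => ?_, fun m n => ?_, fun n => ?_, fun y => ?_⟩
  -- With `z = K n x` and `x = ε n • z - T (T z)`, both terms of `⟨T z, x⟩` vanish by skewness of
  -- `T`, at `z` and at `T z`.
  · have h1 := hT (K n x)
    have h2 := hsk (K n x) (T (T (K n x)))
    have hT2 := hT (T (K n x))
    have h3 : x = ε n • K n x - T (T (K n x)) := (hMK n x).symm
    simp only [neg_apply, mul_apply_eq_comp, inner_neg_left]
    have e : inner ℝ (T (K n x)) x = inner ℝ (T (K n x)) (ε n • K n x - T (T (K n x))) := by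
      rw [← h3]
    rw [e, inner_sub_right, inner_smul_right, h1, real_inner_comm, hT2]
    simp
  · exact (((Commute.refl T).mul_left (hTK m).symm).mul_right
      ((hTK n).mul_left (hKK m n))).neg_left.neg_right
  · exact ((Commute.refl T).mul_right (hTK n)).neg_right
  -- `-T² K n = 1 - ε n • K n`, by the definition of `K n` and commutation.
  · have e : ∀ n, (-(T * K n)) (T y) = y - ε n • K n y := by
      intro n
      have h1 : K n (T y) = T (K n y) :=
        congrArg (fun F : H →L[ℝ] H => F y) (hTK n).eq.symm
      have h2 : ε n • K n y - T (T (K n y)) = y := hMK n y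
      simp only [neg_apply, mul_apply_eq_comp, h1]
      nth_rewrite 2 [← h2]
      abel
    simp only [e]
    simpa using tendsto_const_nhds.sub (hK0 y)

/-- The inverse of an injective bounded skew operator generates a group. -/
theorem exists_hasDerivAt_of_skew {T : H →L[ℝ] H} (hT : ∀ x, inner ℝ (T x) x = 0)
    (hinj : ∀ x, T x = 0 → x = 0) (y : H) :
    ∃ v : ℝ → H, Continuous v ∧ v 0 = y ∧ ∀ t, HasDerivAt (fun t => T (v t)) (v t) t := by
  obtain ⟨A, hA, hAA, hTA, hAT⟩ := exists_skew_approximation hT hinj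
  obtain ⟨S, hS⟩ := exists_tendstoUniformlyOn_exp_smul hA hAA
    (denseRange_of_inner_self_eq_zero hT hinj)
    (by rintro _ ⟨x, rfl⟩; exact (hAT x).cauchySeq) y
  have hloc : ∀ {F : ℕ → ℝ → H} {G : ℝ → H}, (∀ R, TendstoUniformlyOn F G Filter.atTop
      (Icc (-R) R)) → TendstoLocallyUniformlyOn F G Filter.atTop univ := by
    intro F G h
    rw [tendstoLocallyUniformlyOn_iff_forall_isCompact isOpen_univ]
    intro K _ hK
    obtain ⟨R, hR⟩ := hK.isBounded.subset_closedBall 0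
    rw [Real.closedBall_eq_Icc, zero_sub, zero_add] at hR
    exact (h R).mono hR
  have hpt : ∀ t, Filter.Tendsto (fun n => NormedSpace.exp (t • A n) y) Filter.atTop (𝓝 (S t)) :=
    fun t => (hloc hS).tendsto_at (mem_univ t)
  refine ⟨S, ?_, ?_, fun t => ?_⟩
  · rw [← continuousOn_univ]
    refine (hloc hS).continuousOn (Filter.Frequently.of_forall fun n => ?_)
    exact fun t _ => (hasDerivAt_exp_smul_apply (A n) y t).continuousAt.continuousWithinAt
  · have h := hpt 0
    simp only [zero_smul, NormedSpace.exp_zero, one_apply_eq_self] at h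
    exact tendsto_nhds_unique h tendsto_const_nhds
  -- The approximants `exp (t • A n) (T y) = T (exp (t • A n) y)` tend to `T (S t)`. Their
  -- derivatives `exp (t • A n) (A n (T y))` tend to `S t` locally uniformly, since the exponentials
  -- are isometries and `A n (T y) → y`.
  · refine hasDerivAt_of_tendstoLocallyUniformlyOn (l := Filter.atTop) isOpen_univ
      (f := fun n t => NormedSpace.exp (t • A n) (T y))
      (f' := fun n t => NormedSpace.exp (t • A n) (A n (T y))) (hloc fun R => ?_)
      (Filter.Eventually.of_forall fun n t _ => hasDerivAt_exp_smul_apply (A n) (T y) t)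
      (fun t _ => ?_) (mem_univ t)
    · rw [Metric.tendstoUniformlyOn_iff]
      intro δ hδ
      filter_upwards [Metric.tendstoUniformlyOn_iff.1 (hS R) (δ / 2) (by positivity),
        (Metric.tendsto_nhds.1 (hAT y)) (δ / 2) (by positivity)] with n h1 h2 t ht
      have h3 : dist (NormedSpace.exp (t • A n) y) (NormedSpace.exp (t • A n) (A n (T y)))
          = dist (A n (T y)) y := by
        rw [dist_comm, dist_eq_norm, dist_eq_norm, ← map_sub, norm_exp_smul_apply (hA n)]
      have h4 := h1 t ht
      have h5 := dist_triangle (S t) (NormedSpace.exp (t • A n) y)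
        (NormedSpace.exp (t • A n) (A n (T y)))
      linarith
    · have h : ∀ n, NormedSpace.exp (t • A n) (T y) = T (NormedSpace.exp (t • A n) y) := fun n =>
        congrArg (fun F : H →L[ℝ] H => F y) (((hTA n).smul_right t).exp_right).eq.symm
      simp only [h]
      exact (T.continuous.tendsto _).comp (hpt t)

/-- An everywhere defined skew operator on a Hilbert space is bounded. -/
theorem continuous_of_inner_self_eq_zero {T : H →ₗ[ℝ] H} (hT : ∀ x, inner ℝ (T x) x = 0) :
    Continuous T := by
  -- Hellinger–Toeplitz: skewness moves `T` onto a fixed vector `z`, which identifies the limit of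
  -- `T (u n)` weakly and closes the graph.
  refine T.continuous_of_seq_closed_graph fun u x y hu hTu => ext_inner_right ℝ fun z => ?_
  have h1 : Filter.Tendsto (fun n => inner ℝ (T (u n)) z) Filter.atTop (𝓝 (inner ℝ y z)) :=
    hTu.inner tendsto_const_nhds
  have h2 : Filter.Tendsto (fun n => -inner ℝ (u n) (T z)) Filter.atTop
      (𝓝 (-inner ℝ x (T z))) := (hu.inner tendsto_const_nhds).neg
  simp only [inner_eq_neg_of_inner_self_eq_zero hT] at h1 ⊢
  exact tendsto_nhds_unique h1 h2

/-- A surjective skew operator on a Hilbert space generates a group. -/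
theorem LinearPMap.exists_hasDerivAt_of_skew_of_surjective {A : H →ₗ.[ℝ] H}
    (hA : ∀ u : A.domain, inner ℝ (A u) (u : H) = 0) (hs : Function.Surjective A)
    (u₀ : A.domain) :
    ∃ u : ℝ → A.domain, u 0 = u₀ ∧ (Continuous fun t => A (u t)) ∧
      ∀ t, HasDerivAt (fun t => (u t : H)) (A (u t)) t := by
  let e : A.domain ≃ₗ[ℝ] H := LinearEquiv.ofBijective A.toFun
    ⟨LinearPMap.injective_of_skew_of_surjective hA hs, hs⟩
  have he : ∀ y, A (e.symm y) = y := e.apply_symm_apply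
  let T : H →ₗ[ℝ] H := A.domain.subtype ∘ₗ e.symm.toLinearMap
  have hT : ∀ x, inner ℝ (T x) x = 0 := fun x => by
    have h := hA (e.symm x)
    rw [he, real_inner_comm] at h
    exact h
  have hinj : ∀ x, T x = 0 → x = 0 := fun x hx => by
    have h : e.symm x = 0 := Subtype.ext hx
    simpa using h
  -- The curve `v` is `A u`, hence the starting point `A u₀`; continuity of `v` is continuity of `A
  -- u`.
  obtain ⟨v, hv, hv0, hd⟩ := exists_hasDerivAt_of_skew
    (T := ⟨T, continuous_of_inner_self_eq_zero hT⟩) hT hinj (A u₀)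
  refine ⟨fun t => e.symm (v t), ?_, ?_, fun t => ?_⟩
  · simp only [hv0]
    exact e.symm_apply_apply u₀
  · simpa only [he] using hv
  · rw [he]
    exact hd t

end SkewGroup

/-! ### Primitives and integration by parts on `(0, L)` -/

section Sobolev

variable {L : ℝ}

theorem L2.intervalIntegrable (hL : 0 < L) (g : L2 L) : IntervalIntegrable g volume 0 L :=
  (intervalIntegrable_iff_integrableOn_Ioo_of_le hL.le).2 g.integrableOn

theorem absolutelyContinuousOnInterval_primitive (hL : 0 < L) (c : ℝ) (g : L2 L) :
    AbsolutelyContinuousOnInterval (fun x => c + ∫ y in (0 : ℝ)..x, g y) 0 L :=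
  (ContDiffOn.absolutelyContinuousOnInterval (f := fun _ : ℝ => c) contDiffOn_const).add
    ((g.intervalIntegrable hL).absolutelyContinuousOnInterval_intervalIntegral left_mem_uIcc)

theorem continuousOn_primitive (hL : 0 < L) (c : ℝ) (g : L2 L) :
    ContinuousOn (fun x => c + ∫ y in (0 : ℝ)..x, g y) (Icc 0 L) := by
  have h := (absolutelyContinuousOnInterval_primitive hL c g).continuousOn
  rwa [uIcc_of_le hL.le] at h

theorem ae_deriv_primitive (hL : 0 < L) (c : ℝ) (g : L2 L) :
    ∀ᵐ x, x ∈ uIoc 0 L → deriv (fun x => c + ∫ y in (0 : ℝ)..x, g y) x = g x := by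
  filter_upwards [(g.intervalIntegrable hL).ae_hasDerivAt_integral] with x hx hxI
  exact ((hx (uIoc_subset_uIcc hxI) 0 left_mem_uIcc).const_add c).deriv

/-- Integration by parts between a primitive and an absolutely continuous function. -/
theorem integral_primitive_mul_deriv (hL : 0 < L) (c : ℝ) (g : L2 L) {φ : ℝ → ℝ}
    (hφ : AbsolutelyContinuousOnInterval φ 0 L) :
    ∫ x in (0 : ℝ)..L, (c + ∫ y in (0 : ℝ)..x, g y) * deriv φ x
      = (c + ∫ y in (0 : ℝ)..L, g y) * φ L - c * φ 0 - ∫ x in (0 : ℝ)..L, g x * φ x := by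
  rw [(absolutelyContinuousOnInterval_primitive hL c g).integral_mul_deriv_eq_deriv_mul hφ]
  have hd : ∫ x in (0 : ℝ)..L, deriv (fun x => c + ∫ y in (0 : ℝ)..x, g y) x * φ x
      = ∫ x in (0 : ℝ)..L, g x * φ x := by
    refine intervalIntegral.integral_congr_ae ?_
    filter_upwards [ae_deriv_primitive hL c g] with x hx hxI
    rw [hx hxI]
  rw [hd, intervalIntegral.integral_same, add_zero]

theorem setIntegral_Ioo_eq_intervalIntegral (hL : 0 < L) (f : ℝ → ℝ) :
    ∫ x in Ioo 0 L, f x = ∫ x in (0 : ℝ)..L, f x := by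
  rw [intervalIntegral.integral_of_le hL.le, integral_Ioc_eq_integral_Ioo]

/-- Converse of `HasWeakDeriv.ae_eq_primitive`: the boundary terms vanish because a test function is
zero at both ends. -/
theorem hasWeakDeriv_of_ae_eq_primitive (hL : 0 < L) {f g : L2 L} {c : ℝ}
    (h : ∀ᵐ x ∂volume.restrict (Ioo 0 L), f x = c + ∫ y in (0 : ℝ)..x, g y) :
    HasWeakDeriv f g := by
  intro φ hφ
  have hφac : AbsolutelyContinuousOnInterval φ 0 L :=
    ContDiffOn.absolutelyContinuousOnInterval (hφ.contDiff.of_le (by simp)).contDiffOn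
  have hφ0 : φ 0 = 0 := image_eq_zero_of_notMem_tsupport
    fun h' => lt_irrefl _ (hφ.tsupport_subset h').1
  have hφL : φ L = 0 := image_eq_zero_of_notMem_tsupport
    fun h' => lt_irrefl _ (hφ.tsupport_subset h').2
  have e : ∫ x in Ioo 0 L, f x * deriv φ x
      = ∫ x in Ioo 0 L, (c + ∫ y in (0 : ℝ)..x, g y) * deriv φ x := by
    refine integral_congr_ae ?_
    filter_upwards [h] with x hx
    rw [hx]
  rw [e, setIntegral_Ioo_eq_intervalIntegral hL, setIntegral_Ioo_eq_intervalIntegral hL,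
    integral_primitive_mul_deriv hL c g hφac, hφ0, hφL]
  ring

theorem pointValue_of_ae_eq_primitive (hL : 0 < L) {f g : L2 L} {c : ℝ}
    (h : ∀ᵐ x ∂volume.restrict (Ioo 0 L), f x = c + ∫ y in (0 : ℝ)..x, g y) {x : ℝ}
    (hx : x ∈ Icc 0 L) : pointValue f x = c + ∫ y in (0 : ℝ)..x, g y :=
  IsContRep.pointValue_eq hL ⟨continuousOn_primitive hL c g, h⟩ hx

/-- Integration by parts in `H¹(0, L)`. -/
theorem inner_weakDeriv_add_inner_weakDeriv (hL : 0 < L) {f g : L2 L} (hf : f ∈ H1 L)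
    (hg : g ∈ H1 L) :
    inner ℝ (weakDeriv f) g + inner ℝ f (weakDeriv g)
      = pointValue f L * pointValue g L - pointValue f 0 * pointValue g 0 := by
  obtain ⟨c, hc⟩ := (hasWeakDeriv_weakDeriv hf).ae_eq_primitive hL
  obtain ⟨d, hd⟩ := (hasWeakDeriv_weakDeriv hg).ae_eq_primitive hL
  have h0 : (0 : ℝ) ∈ Icc 0 L := left_mem_Icc.2 hL.le
  have hL' : L ∈ Icc 0 L := right_mem_Icc.2 hL.le
  -- Both functions are replaced by their primitive representatives, which are absolutely
  -- continuous.
  have h := integral_primitive_mul_deriv hL c (weakDeriv f)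
    (absolutelyContinuousOnInterval_primitive hL d (weakDeriv g))
  have e1 : ∫ x in (0 : ℝ)..L, (c + ∫ y in (0 : ℝ)..x, weakDeriv f y)
      * deriv (fun x => d + ∫ y in (0 : ℝ)..x, weakDeriv g y) x = inner ℝ f (weakDeriv g) := by
    rw [L2.inner_def, setIntegral_Ioo_eq_intervalIntegral hL]
    refine intervalIntegral.integral_congr_ae_restrict ?_
    rw [uIoc_of_le hL.le, ← restrict_Ioo_eq_restrict_Ioc]
    filter_upwards [hc, ae_restrict_mem measurableSet_Ioo,
      ae_restrict_of_ae (ae_deriv_primitive hL d (weakDeriv g))] with x h1 h2 h3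
    rw [h1, h3 (by rw [uIoc_of_le hL.le]; exact Ioo_subset_Ioc_self h2)]
    simp [mul_comm]
  have e2 : ∫ x in (0 : ℝ)..L, weakDeriv f x * (d + ∫ y in (0 : ℝ)..x, weakDeriv g y)
      = inner ℝ (weakDeriv f) g := by
    rw [L2.inner_def, ← setIntegral_Ioo_eq_intervalIntegral hL]
    refine integral_congr_ae ?_
    filter_upwards [hd] with x h1
    rw [h1]
    simp [mul_comm]
  rw [e1, e2] at h
  rw [pointValue_of_ae_eq_primitive hL hc h0, pointValue_of_ae_eq_primitive hL hc hL',
    pointValue_of_ae_eq_primitive hL hd h0, pointValue_of_ae_eq_primitive hL hd hL', h]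
  simp only [intervalIntegral.integral_same, add_zero]
  ring

/-- The constant function `1`. -/
def L2.one (L : ℝ) : L2 L := Lp.const 2 _ 1

theorem L2.coeFn_one : L2.one L =ᵐ[volume.restrict (Ioo 0 L)] fun _ => (1 : ℝ) :=
  Lp.coeFn_const _ _ _

/-- Cauchy–Schwarz against the constant `1`, after enlarging `(0, x)` to `(0, L)`. -/
theorem abs_integral_le_norm_mul_norm_one (hL : 0 < L) (f : L2 L) {x : ℝ} (hx : x ∈ Icc 0 L) :
    |∫ y in (0 : ℝ)..x, f y| ≤ ‖L2.one L‖ * ‖f‖ := by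
  have h1 : |∫ y in (0 : ℝ)..x, f y| ≤ ∫ y in (0 : ℝ)..x, |f y| :=
    intervalIntegral.abs_integral_le_integral_abs hx.1
  have h2 : ∫ y in (0 : ℝ)..x, |f y| ≤ ∫ y in (0 : ℝ)..L, |f y| :=
    intervalIntegral.integral_mono_interval le_rfl hx.1 hx.2
      (Filter.Eventually.of_forall fun y => abs_nonneg _) (f.intervalIntegrable hL).abs
  have h3 : ∫ y in (0 : ℝ)..L, |f y| = inner ℝ (L2.one L) |f| := by
    rw [L2.inner_def, ← setIntegral_Ioo_eq_intervalIntegral hL]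
    refine integral_congr_ae ?_
    filter_upwards [Lp.coeFn_abs f, L2.coeFn_one] with x h1 h2
    rw [h1, h2]
    simp
  have h4 := real_inner_le_norm (L2.one L) |f|
  rw [norm_abs_eq_norm] at h4
  linarith

theorem memLp_primitive (hL : 0 < L) (g : L2 L) :
    MemLp (fun x => ∫ y in (0 : ℝ)..x, g y) 2 (volume.restrict (Ioo 0 L)) := by
  have h := (continuousOn_primitive hL 0 g).mono Ioo_subset_Icc_self
  simp only [zero_add] at h
  refine MemLp.of_bound (h.aestronglyMeasurable measurableSet_Ioo) (‖L2.one L‖ * ‖g‖) ?_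
  filter_upwards [ae_restrict_mem measurableSet_Ioo] with x hx
  exact abs_integral_le_norm_mul_norm_one hL g (Ioo_subset_Icc_self hx)

theorem integral_L2_smul (c : ℝ) (f : L2 L) {x : ℝ} (hx : x ∈ Icc 0 L) :
    ∫ y in (0 : ℝ)..x, (c • f : L2 L) y = c * ∫ y in (0 : ℝ)..x, f y := by
  rw [← intervalIntegral.integral_const_mul]
  refine intervalIntegral.integral_congr_ae_restrict ?_
  rw [uIoc_of_le hx.1, ← restrict_Ioo_eq_restrict_Ioc]
  exact ae_restrict_of_ae_restrict_of_subset (Ioo_subset_Ioo_right hx.2) (Lp.coeFn_smul c f)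

theorem one_ae_eq : ∀ᵐ x ∂volume.restrict (Ioo 0 L),
    L2.one L x = 1 + ∫ y in (0 : ℝ)..x, (0 : L2 L) y := by
  filter_upwards [L2.coeFn_one, ae_restrict_mem measurableSet_Ioo] with x hx hxI
  -- The representative of `0` in `L²` is only almost everywhere zero, so its integral is computed
  -- by homogeneity.
  have h := integral_L2_smul 0 (0 : L2 L) (Ioo_subset_Icc_self hxI)
  rw [smul_zero, zero_mul] at h
  rw [hx, h, add_zero]

variable [hL : Fact (0 < L)]

theorem L2.intervalIntegrable_of_mem (g : L2 L) {x : ℝ} (hx : x ∈ Icc 0 L) :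
    IntervalIntegrable g volume 0 x :=
  (g.intervalIntegrable hL.out).mono_set (by
    rw [uIcc_of_le hx.1, uIcc_of_le hL.out.le]; exact Icc_subset_Icc_right hx.2)

theorem integral_L2_add (f g : L2 L) {x : ℝ} (hx : x ∈ Icc 0 L) :
    ∫ y in (0 : ℝ)..x, (f + g : L2 L) y
      = (∫ y in (0 : ℝ)..x, f y) + ∫ y in (0 : ℝ)..x, g y := by
  rw [← intervalIntegral.integral_add (f.intervalIntegrable_of_mem hx)
    (g.intervalIntegrable_of_mem hx)]
  refine intervalIntegral.integral_congr_ae_restrict ?_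
  rw [uIoc_of_le hx.1, ← restrict_Ioo_eq_restrict_Ioc]
  exact ae_restrict_of_ae_restrict_of_subset (Ioo_subset_Ioo_right hx.2) (Lp.coeFn_add f g)

/-- The primitive vanishing at `0`, as a bounded operator on `L²(0, L)`. -/
def primitive (L : ℝ) [hL : Fact (0 < L)] : L2 L →L[ℝ] L2 L :=
  LinearMap.mkContinuousOfExistsBound
    { toFun := fun g => (memLp_primitive hL.out g).toLp
      map_add' := fun f g => by
        refine Lp.ext ?_
        filter_upwards [(memLp_primitive hL.out (f + g)).coeFn_toLp,
          (memLp_primitive hL.out f).coeFn_toLp, (memLp_primitive hL.out g).coeFn_toLp,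
          Lp.coeFn_add (memLp_primitive hL.out f).toLp (memLp_primitive hL.out g).toLp,
          ae_restrict_mem measurableSet_Ioo] with x h1 h2 h3 h4 h5
        rw [h1, h4, Pi.add_apply, h2, h3, integral_L2_add f g (Ioo_subset_Icc_self h5)]
      map_smul' := fun c f => by
        refine Lp.ext ?_
        filter_upwards [(memLp_primitive hL.out (c • f)).coeFn_toLp,
          (memLp_primitive hL.out f).coeFn_toLp,
          Lp.coeFn_smul c (memLp_primitive hL.out f).toLp,
          ae_restrict_mem measurableSet_Ioo] with x h1 h2 h3 h4
        rw [h1, RingHom.id_apply, h3, Pi.smul_apply, h2,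
          integral_L2_smul c f (Ioo_subset_Icc_self h4), smul_eq_mul] }
    -- The pointwise bound `‖1‖ ‖g‖` becomes an `L²` bound through the square root of the total
    -- measure.
    ⟨(measureUnivNNReal (volume.restrict (Ioo 0 L)) : ℝ) ^ (2 : ENNReal).toReal⁻¹ * ‖L2.one L‖,
      fun g => by
        rw [mul_assoc]
        refine Lp.norm_le_of_ae_bound (by positivity) ?_
        filter_upwards [(memLp_primitive hL.out g).coeFn_toLp,
          ae_restrict_mem measurableSet_Ioo] with x h1 h2
        exact (congrArg norm h1).trans_le
          (abs_integral_le_norm_mul_norm_one hL.out g (Ioo_subset_Icc_self h2))⟩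

theorem primitive_ae_eq (g : L2 L) :
    ∀ᵐ x ∂volume.restrict (Ioo 0 L), primitive L g x = 0 + ∫ y in (0 : ℝ)..x, g y := by
  filter_upwards [(memLp_primitive hL.out g).coeFn_toLp] with x h
  rw [zero_add]
  exact h

theorem hasWeakDeriv_primitive (g : L2 L) : HasWeakDeriv (primitive L g) g :=
  hasWeakDeriv_of_ae_eq_primitive hL.out (primitive_ae_eq g)

theorem weakDeriv_primitive (g : L2 L) : weakDeriv (primitive L g) = g :=
  (hasWeakDeriv_primitive g).weakDeriv_eq

theorem primitive_mem_H1star (g : L2 L) : primitive L g ∈ H1star L :=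
  ⟨⟨g, hasWeakDeriv_primitive g⟩, by
    rw [pointValue_of_ae_eq_primitive hL.out (primitive_ae_eq g) (left_mem_Icc.2 hL.out.le)]
    simp⟩

theorem primitive_weakDeriv {f : L2 L} (hf : f ∈ H1star L) : primitive L (weakDeriv f) = f := by
  have hp := primitive_mem_H1star (weakDeriv f)
  have h := eq_zero_of_mem_H1star ((H1star L).add_mem hp ((H1star L).smul_mem (-1) hf)) (by
    rw [weakDeriv_add hp.1 ((H1 L).smul_mem _ hf.1), weakDeriv_smul _ hf.1, weakDeriv_primitive]
    simp)
  rwa [neg_one_smul, ← sub_eq_add_neg, sub_eq_zero] at h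

theorem hasWeakDeriv_one : HasWeakDeriv (L2.one L) 0 :=
  hasWeakDeriv_of_ae_eq_primitive hL.out one_ae_eq

theorem pointValue_one {x : ℝ} (hx : x ∈ Icc 0 L) : pointValue (L2.one L) x = 1 := by
  rw [pointValue_of_ae_eq_primitive hL.out one_ae_eq hx]
  have h := integral_L2_smul 0 (0 : L2 L) hx
  rw [smul_zero, zero_mul] at h
  rw [h, add_zero]

/-- Integration by parts against the constant `1`. -/
theorem pointValue_primitive_right (g : L2 L) :
    pointValue (primitive L g) L = inner ℝ (L2.one L) g := by
  have h := inner_weakDeriv_add_inner_weakDeriv hL.out ⟨0, hasWeakDeriv_one⟩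
    (primitive_mem_H1star g).1
  rw [hasWeakDeriv_one.weakDeriv_eq, weakDeriv_primitive, inner_zero_left, zero_add,
    (primitive_mem_H1star g).2, mul_zero, sub_zero,
    pointValue_one (right_mem_Icc.2 hL.out.le), one_mul] at h
  exact h.symm

/-- The map `f ↦ ∫ₓᴸ f`, as a bounded operator on `L²(0, L)`. -/
def coprimitive (L : ℝ) [hL : Fact (0 < L)] : L2 L →L[ℝ] L2 L :=
  (innerSL ℝ (L2.one L)).smulRight (L2.one L) - primitive L

theorem coprimitive_apply (f : L2 L) :
    coprimitive L f = inner ℝ (L2.one L) f • L2.one L + (-1 : ℝ) • primitive L f := by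
  simp [coprimitive, sub_eq_add_neg]

theorem hasWeakDeriv_coprimitive (f : L2 L) : HasWeakDeriv (coprimitive L f) (-f) := by
  rw [coprimitive_apply]
  have h := (hasWeakDeriv_one.smul (inner ℝ (L2.one L) f)).add
    ((hasWeakDeriv_primitive f).smul (-1))
  simpa using h

theorem pointValue_coprimitive_right (f : L2 L) : pointValue (coprimitive L f) L = 0 := by
  have h : L ∈ Icc 0 L := right_mem_Icc.2 hL.out.le
  rw [coprimitive_apply, pointValue_add hL.out ((H1 L).smul_mem _ ⟨0, hasWeakDeriv_one⟩)
    ((H1 L).smul_mem _ (primitive_mem_H1star f).1) h, pointValue_smul hL.out _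
    ⟨0, hasWeakDeriv_one⟩ h, pointValue_smul hL.out _ (primitive_mem_H1star f).1 h,
    pointValue_one h, pointValue_primitive_right]
  ring

/-- `coprimitive` is adjoint to `primitive`: one factor vanishes at `L`, the other at `0`, so no
boundary term survives. -/
theorem inner_coprimitive_primitive (p : L2 L) :
    inner ℝ (coprimitive L (primitive L p)) p = ‖primitive L p‖ ^ 2 := by
  have h := inner_weakDeriv_add_inner_weakDeriv hL.out
    ⟨_, hasWeakDeriv_coprimitive (primitive L p)⟩ (primitive_mem_H1star p).1
  rw [(hasWeakDeriv_coprimitive _).weakDeriv_eq, weakDeriv_primitive, inner_neg_left,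
    real_inner_self_eq_norm_sq, pointValue_coprimitive_right, (primitive_mem_H1star p).2] at h
  linarith

/-- Solvability of `p' = h + c ∫₀ˣ p`, `p(L) = d`, for `c ≥ 0`. -/
theorem exists_weakDeriv_eq_add_primitive {c : ℝ} (hc : 0 ≤ c) (h : L2 L) (d : ℝ) :
    ∃ p : L2 L, p ∈ H1 L ∧ weakDeriv p = h + c • primitive L p ∧ pointValue p L = d := by
  -- Integrating the equation back from `L` gives `p + c ∫ₓᴸ ∫₀ʸ p = d - ∫ₓᴸ h`. The operator on the
  -- left is coercive with constant `1` because `c ≥ 0`.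
  let M : L2 L →L[ℝ] L2 L := 1 + c • (coprimitive L * primitive L)
  have hM : IsUnit M := by
    refine ContinuousLinearMap.isUnit_of_forall_le_norm_inner_map M (c := 1) one_pos fun p => ?_
    have e : inner ℝ (M p) p = ‖p‖ ^ 2 + c * ‖primitive L p‖ ^ 2 := by
      rw [← inner_coprimitive_primitive, ← real_inner_self_eq_norm_sq, ← real_inner_smul_left,
        ← inner_add_left]
      rfl
    rw [e]
    refine le_trans ?_ (le_abs_self _)
    simp only [NNReal.coe_one, mul_one]
    have := mul_nonneg hc (sq_nonneg ‖primitive L p‖)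
    linarith
  let r : L2 L := d • L2.one L + (-1 : ℝ) • coprimitive L h
  let p : L2 L := Ring.inverse M r
  have hp : p + c • coprimitive L (primitive L p) = r :=
    congrArg (fun F : L2 L →L[ℝ] L2 L => F r) (Ring.mul_inverse_cancel M hM)
  have hp' : p = d • L2.one L + (-1 : ℝ) • coprimitive L (h + c • primitive L p) := by
    refine (eq_sub_of_add_eq hp).trans ?_
    rw [map_add, map_smul]
    simp only [r]
    module
  have hd : HasWeakDeriv p (h + c • primitive L p) := by
    have := (hasWeakDeriv_one (L := L).smul d).add
      ((hasWeakDeriv_coprimitive (h + c • primitive L p)).smul (-1))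
    rwa [← hp', smul_zero, zero_add, neg_one_smul, neg_neg] at this
  have hL' : L ∈ Icc 0 L := right_mem_Icc.2 hL.out.le
  refine ⟨p, ⟨_, hd⟩, hd.weakDeriv_eq, ?_⟩
  rw [hp', pointValue_add hL.out ((H1 L).smul_mem _ ⟨0, hasWeakDeriv_one⟩)
    ((H1 L).smul_mem _ ⟨_, hasWeakDeriv_coprimitive _⟩) hL', pointValue_smul hL.out _
    ⟨0, hasWeakDeriv_one⟩ hL', pointValue_smul hL.out _ ⟨_, hasWeakDeriv_coprimitive _⟩ hL',
    pointValue_one hL', pointValue_coprimitive_right]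
  ring

end Sobolev

/-! ### Completeness of the energy space -/

namespace PhaseSpace

variable {P : Beam}

theorem norm_sq_eq_energyInner (U : PhaseSpace P) : ‖U‖ ^ 2 = energyInner U U :=
  (real_inner_self_eq_norm_sq U).symm

theorem weakDeriv_ξ_sub (U V : PhaseSpace P) :
    weakDeriv (U - V).ξ = weakDeriv U.ξ - weakDeriv V.ξ := by
  have h := weakDeriv_add (U - V).ξ_mem.1 V.ξ_mem.1
  rw [← ξ_add, sub_add_cancel] at h
  rw [h, add_sub_cancel_right]

theorem weakDeriv_s_sub (U V : PhaseSpace P) :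
    weakDeriv (U - V).s = weakDeriv U.s - weakDeriv V.s := by
  have h := weakDeriv_add (U - V).s_mem.1 V.s_mem.1
  rw [← s_add, sub_add_cancel] at h
  rw [h, add_sub_cancel_right]

theorem shear_sub (U V : PhaseSpace P) : (U - V).shear = U.shear - V.shear := by
  have h := shear_add (U - V) V
  rw [sub_add_cancel] at h
  rw [h, add_sub_cancel_right]

/-- A component controlled by the energy is Lipschitz and so preserves Cauchy sequences. The limit
is stated for squared norms because the energy is a sum of squares. -/
theorem exists_tendsto_of_cauchySeq {E : Type*} [NormedAddCommGroup E] [CompleteSpace E]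
    {φ : PhaseSpace P → E} (hsub : ∀ U V, φ (U - V) = φ U - φ V) {a : ℝ} (ha : 0 < a)
    (hle : ∀ U, a * ‖φ U‖ ^ 2 ≤ energyInner U U) {u : ℕ → PhaseSpace P} (hu : CauchySeq u) :
    ∃ z, Filter.Tendsto (fun n => ‖φ (u n) - z‖ ^ 2) Filter.atTop (𝓝 0) := by
  have hb : ∀ U, ‖φ U‖ ≤ (√a)⁻¹ * ‖U‖ := by
    intro U
    have h := hle U
    rw [← norm_sq_eq_energyInner] at h
    refine abs_le_of_sq_le_sq' ?_ (by positivity) |>.2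
    rw [mul_pow, inv_pow, Real.sq_sqrt ha.le, inv_mul_eq_div, le_div_iff₀ ha]
    linarith
  have hc : CauchySeq fun n => φ (u n) := by
    have hl : LipschitzWith (Real.toNNReal (√a)⁻¹) φ := LipschitzWith.of_dist_le_mul fun U V => by
      rw [dist_eq_norm, dist_eq_norm, ← hsub, Real.coe_toNNReal _ (by positivity)]
      exact hb _
    exact hl.uniformContinuous.comp_cauchySeq hu
  obtain ⟨z, hz⟩ := cauchySeq_tendsto_of_complete hc
  refine ⟨z, ?_⟩
  have h := (tendsto_iff_norm_sub_tendsto_zero.1 hz).pow 2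
  simpa using h

theorem energyInner_self_bounds (U : PhaseSpace P) :
    3 * P.ρ₁ * ‖U.Ψ₁‖ ^ 2 ≤ energyInner U U ∧ 3 * P.ρ₂ * ‖U.Ψ₂‖ ^ 2 ≤ energyInner U U ∧
    P.ρ₂ * ‖U.Ψ₃‖ ^ 2 ≤ energyInner U U ∧ 3 * P.b * ‖weakDeriv U.ξ‖ ^ 2 ≤ energyInner U U ∧
    P.b * ‖weakDeriv U.s‖ ^ 2 ≤ energyInner U U ∧ 3 * P.k * ‖U.shear‖ ^ 2 ≤ energyInner U U ∧
    3 * P.k * ‖U.Ψ₄‖ ^ 2 ≤ energyInner U U ∧ 3 * P.b * ‖U.Ψ₅‖ ^ 2 ≤ energyInner U U ∧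
    P.b * ‖U.Ψ₆‖ ^ 2 ≤ energyInner U U := by
  have := P.ρ₁_pos; have := P.ρ₂_pos; have := P.k_pos; have := P.b_pos; have := P.γ_pos
  rw [energyInner_self]
  have p1 : 0 ≤ 3 * P.ρ₁ * ‖U.Ψ₁‖ ^ 2 := by positivity
  have p2 : 0 ≤ 3 * P.ρ₂ * ‖U.Ψ₂‖ ^ 2 := by positivity
  have p3 : 0 ≤ P.ρ₂ * ‖U.Ψ₃‖ ^ 2 := by positivity
  have p4 : 0 ≤ 3 * P.b * ‖weakDeriv U.ξ‖ ^ 2 := by positivity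
  have p5 : 0 ≤ P.b * ‖weakDeriv U.s‖ ^ 2 := by positivity
  have p6 : 0 ≤ P.γ * ‖U.s‖ ^ 2 := by positivity
  have p7 : 0 ≤ 3 * P.k * ‖U.shear‖ ^ 2 := by positivity
  have p8 : 0 ≤ 3 * P.k * U.Ψ₄ ^ 2 := by positivity
  have p9 : 0 ≤ 3 * P.b * U.Ψ₅ ^ 2 := by positivity
  have p10 : 0 ≤ P.b * U.Ψ₆ ^ 2 := by positivity
  simp only [Real.norm_eq_abs, sq_abs]
  refine ⟨?_, ?_, ?_, ?_, ?_, ?_, ?_, ?_, ?_⟩ <;> linarith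

/-- The vector with given shear strain and given derivatives `ξ_x` and `s_x`. -/
def ofStrain (σ p q a₁ a₂ a₃ : L2 P.L) (r₁ r₂ r₃ : ℝ) : PhaseSpace P :=
  mk ⟨primitive P.L (σ - primitive P.L p - primitive P.L q), primitive_mem_H1star _⟩ a₁
    ⟨primitive P.L p, primitive_mem_H1star _⟩ a₂ ⟨primitive P.L q, primitive_mem_H1star _⟩ a₃
    r₁ r₂ r₃

theorem shear_ofStrain (σ p q a₁ a₂ a₃ : L2 P.L) (r₁ r₂ r₃ : ℝ) :
    (ofStrain σ p q a₁ a₂ a₃ r₁ r₂ r₃).shear = σ := by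
  simp only [shear, ofStrain, w_mk, ξ_mk, s_mk, weakDeriv_primitive]
  abel

/-- Shear, `ξ_x`, `s_x` and the remaining components converge separately, and `ofStrain` reassembles
their limits into a vector of `ℋ`. -/
instance : CompleteSpace (PhaseSpace P) := by
  refine Metric.complete_of_cauchySeq_tendsto fun u hu => ?_
  have := P.ρ₁_pos; have := P.ρ₂_pos; have := P.k_pos; have := P.b_pos
  have hB := energyInner_self_bounds (P := P)
  obtain ⟨a₁, h1⟩ := exists_tendsto_of_cauchySeq (φ := Ψ₁) (fun _ _ => rfl) (by positivity)
    (fun U => (hB U).1) hu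
  obtain ⟨a₂, h2⟩ := exists_tendsto_of_cauchySeq (φ := Ψ₂) (fun _ _ => rfl) (by positivity)
    (fun U => (hB U).2.1) hu
  obtain ⟨a₃, h3⟩ := exists_tendsto_of_cauchySeq (φ := Ψ₃) (fun _ _ => rfl) (by positivity)
    (fun U => (hB U).2.2.1) hu
  obtain ⟨p, h4⟩ := exists_tendsto_of_cauchySeq (φ := fun U => weakDeriv U.ξ) weakDeriv_ξ_sub
    (by positivity) (fun U => (hB U).2.2.2.1) hu
  obtain ⟨q, h5⟩ := exists_tendsto_of_cauchySeq (φ := fun U => weakDeriv U.s) weakDeriv_s_sub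
    (by positivity) (fun U => (hB U).2.2.2.2.1) hu
  obtain ⟨σ, h6⟩ := exists_tendsto_of_cauchySeq (φ := shear) shear_sub
    (by positivity) (fun U => (hB U).2.2.2.2.2.1) hu
  obtain ⟨r₁, h7⟩ := exists_tendsto_of_cauchySeq (φ := Ψ₄) (fun _ _ => rfl) (by positivity)
    (fun U => (hB U).2.2.2.2.2.2.1) hu
  obtain ⟨r₂, h8⟩ := exists_tendsto_of_cauchySeq (φ := Ψ₅) (fun _ _ => rfl) (by positivity)
    (fun U => (hB U).2.2.2.2.2.2.2.1) hu
  obtain ⟨r₃, h9⟩ := exists_tendsto_of_cauchySeq (φ := Ψ₆) (fun _ _ => rfl) (by positivity)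
    (fun U => (hB U).2.2.2.2.2.2.2.2) hu
  let V : PhaseSpace P := ofStrain σ p q a₁ a₂ a₃ r₁ r₂ r₃
  have hV4 : weakDeriv V.ξ = p := weakDeriv_primitive p
  have hV5 : weakDeriv V.s = q := weakDeriv_primitive q
  have hV6 : V.shear = σ := shear_ofStrain ..
  -- The term `γ ‖s‖²` needs no limit of its own: `s` is the primitive of `s_x`, and `primitive` is
  -- bounded.
  have hs : ∀ n, ‖(u n - V).s‖ ^ 2 ≤ ‖primitive P.L‖ ^ 2 * ‖weakDeriv (u n).s - q‖ ^ 2 := by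
    intro n
    rw [← mul_pow, ← hV5, ← weakDeriv_s_sub]
    refine pow_le_pow_left₀ (norm_nonneg _) ?_ 2
    have h := (primitive P.L).le_opNorm (weakDeriv (u n - V).s)
    rwa [primitive_weakDeriv (u n - V).s_mem] at h
  have h10 : Filter.Tendsto (fun n => ‖(u n - V).s‖ ^ 2) Filter.atTop (𝓝 0) :=
    squeeze_zero (fun _ => by positivity) hs (by simpa using h5.const_mul (‖primitive P.L‖ ^ 2))
  refine ⟨V, ?_⟩
  have hlim : Filter.Tendsto (fun n => ‖u n - V‖ ^ 2) Filter.atTop (𝓝 0) := by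
    have e : ∀ n, ‖u n - V‖ ^ 2 = 3 * P.ρ₁ * ‖(u n).Ψ₁ - a₁‖ ^ 2 + 3 * P.ρ₂ * ‖(u n).Ψ₂ - a₂‖ ^ 2
        + P.ρ₂ * ‖(u n).Ψ₃ - a₃‖ ^ 2 + 3 * P.b * ‖weakDeriv (u n).ξ - p‖ ^ 2
        + P.b * ‖weakDeriv (u n).s - q‖ ^ 2 + P.γ * ‖(u n - V).s‖ ^ 2
        + 3 * P.k * ‖(u n).shear - σ‖ ^ 2 + 3 * P.k * ‖(u n).Ψ₄ - r₁‖ ^ 2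
        + 3 * P.b * ‖(u n).Ψ₅ - r₂‖ ^ 2 + P.b * ‖(u n).Ψ₆ - r₃‖ ^ 2 := by
      intro n
      rw [norm_sq_eq_energyInner, energyInner_self, weakDeriv_ξ_sub, weakDeriv_s_sub, shear_sub,
        hV4, hV5, hV6]
      simp only [Real.norm_eq_abs, sq_abs]
      rfl
    simp only [e]
    have h := ((((((((((h1.const_mul (3 * P.ρ₁)).add (h2.const_mul (3 * P.ρ₂))).add
      (h3.const_mul P.ρ₂)).add (h4.const_mul (3 * P.b))).add (h5.const_mul P.b)).add
      (h10.const_mul P.γ)).add (h6.const_mul (3 * P.k))).add (h7.const_mul (3 * P.k))).add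
      (h8.const_mul (3 * P.b))).add (h9.const_mul P.b))
    simpa using h
  rw [tendsto_iff_norm_sub_tendsto_zero]
  simpa using hlim.sqrt

end PhaseSpace

/-! ### The beam operator is skew and surjective -/

/-- Velocities vanish at `0`. At `L` the stress–velocity products cancel against the terms in `Ψ₄`,
`Ψ₅`, `Ψ₆`, which are the velocities there. The zeroth order couplings cancel because the shear of
`𝒜U` is `(Ψ₁)_x + Ψ₂ + Ψ₃`. -/
theorem inner_operatorA_self (P : Beam) (U : (operatorA P).domain) :
    inner ℝ (operatorA P U) (U : PhaseSpace P) = 0 := by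
  obtain ⟨U, hU⟩ := U
  change PhaseSpace.energyInner (applyA U hU) U = 0
  have hL : P.L ∈ Icc 0 P.L := right_mem_Icc.2 P.L_pos.le
  have i1 := inner_weakDeriv_add_inner_weakDeriv P.L_pos (shear_mem_H1 hU) hU.2.1.1.1
  have i2 := inner_weakDeriv_add_inner_weakDeriv P.L_pos hU.1.2.1.2 hU.2.1.2.1.1
  have i3 := inner_weakDeriv_add_inner_weakDeriv P.L_pos hU.1.2.2.2 hU.2.1.2.2.1
  rw [hU.2.1.1.2, ← hU.2.2.1, mul_zero, sub_zero] at i1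
  rw [hU.2.1.2.1.2, ← hU.2.2.2.1, mul_zero, sub_zero] at i2
  rw [hU.2.1.2.2.2, ← hU.2.2.2.2, mul_zero, sub_zero] at i3
  have v : pointValue U.shear P.L
      = pointValue (weakDeriv U.w) P.L + pointValue U.ξ P.L + pointValue U.s P.L := by
    rw [PhaseSpace.shear, pointValue_add P.L_pos ((H1 _).add_mem hU.1.1.2 U.ξ_mem.1) U.s_mem.1 hL,
      pointValue_add P.L_pos hU.1.1.2 U.ξ_mem.1 hL]
  rw [v] at i1
  have hsh : (applyA U hU).shear = weakDeriv U.Ψ₁ + U.Ψ₂ + U.Ψ₃ := rfl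
  have hρ₁ := P.ρ₁_pos.ne'
  have hρ₂ := P.ρ₂_pos.ne'
  rw [PhaseSpace.energyInner, hsh]
  simp only [applyA, PhaseSpace.Ψ₁_mk, PhaseSpace.ξ_mk,
    PhaseSpace.Ψ₂_mk, PhaseSpace.s_mk, PhaseSpace.Ψ₃_mk, PhaseSpace.Ψ₄_mk, PhaseSpace.Ψ₅_mk,
    PhaseSpace.Ψ₆_mk, inner_add_left, inner_sub_left, real_inner_smul_left]
  rw [real_inner_comm (weakDeriv U.Ψ₁)] at i1
  rw [real_inner_comm (weakDeriv U.Ψ₂)] at i2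
  rw [real_inner_comm (weakDeriv U.Ψ₃)] at i3
  rw [real_inner_comm U.Ψ₂ U.shear, real_inner_comm U.Ψ₃ U.shear, real_inner_comm U.Ψ₃ U.s]
  field_simp
  -- The multipliers are the energy weights of the shear, `ξ_x` and `s_x` terms.
  linear_combination 3 * P.k * i1 + 3 * P.b * i2 + P.b * i3

/-- The odd components of `𝒜U = F` prescribe the velocities. The others determine first the shear
`σ`, then `p = ξ_x` and `q = s_x`, each from a first order equation with its value at `L` given.
Only the equation for `q` keeps a zeroth order term, `(γ / b) ∫₀ˣ q`, from `γ s`. -/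
theorem operatorA_surjective (P : Beam) (F : PhaseSpace P) :
    ∃ U : (operatorA P).domain, operatorA P U = F := by
  have hL : P.L ∈ Icc 0 P.L := right_mem_Icc.2 P.L_pos.le
  have hρ₁ := P.ρ₁_pos; have hρ₂ := P.ρ₂_pos; have hk := P.k_pos; have hb := P.b_pos
  have hγ := P.γ_pos
  -- `le_rfl` selects `c = 0`, so `σ` and `p` are plain integrals.
  obtain ⟨σ, σ1, σ2, σ3⟩ := exists_weakDeriv_eq_add_primitive le_rfl
    ((P.ρ₁ / P.k) • F.Ψ₁) (-F.Ψ₄)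
  obtain ⟨p, p1, p2, p3⟩ := exists_weakDeriv_eq_add_primitive le_rfl
    ((1 / P.b) • (P.ρ₂ • F.Ψ₂ + P.k • σ)) (-F.Ψ₅)
  obtain ⟨q, q1, q2, q3⟩ := exists_weakDeriv_eq_add_primitive (c := P.γ / P.b) (by positivity)
    ((1 / P.b) • (P.ρ₂ • F.Ψ₃ + (3 * P.k) • σ)) (-F.Ψ₆)
  rw [zero_smul, add_zero] at σ2 p2
  let U : PhaseSpace P := PhaseSpace.ofStrain σ p q F.w F.ξ F.s (pointValue F.w P.L)
    (pointValue F.ξ P.L) (pointValue F.s P.L)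
  have hw : weakDeriv U.w = σ + (-1 : ℝ) • (primitive P.L p + primitive P.L q) := by
    refine (weakDeriv_primitive _).trans ?_
    module
  have hξ : weakDeriv U.ξ = p := weakDeriv_primitive p
  have hs : weakDeriv U.s = q := weakDeriv_primitive q
  have hsh : U.shear = σ := PhaseSpace.shear_ofStrain ..
  have hpq := (H1 P.L).add_mem (primitive_mem_H1star p).1 (primitive_mem_H1star q).1
  have hU : U ∈ domainA P := by
    refine ⟨⟨⟨U.w_mem.1, ?_⟩, ⟨U.ξ_mem.1, ?_⟩, ⟨U.s_mem.1, ?_⟩⟩, ⟨F.w_mem, F.ξ_mem, F.s_mem⟩,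
      rfl, rfl, rfl⟩
    · rw [hw]
      exact (H1 _).add_mem σ1 ((H1 _).smul_mem _ hpq)
    · rwa [hξ]
    · rwa [hs]
  refine ⟨⟨U, hU⟩, ?_⟩
  change applyA U hU = F
  apply PhaseSpace.ext'
  · rfl
  · simp only [applyA, PhaseSpace.Ψ₁_mk, hsh, σ2, smul_smul]
    rw [show 1 / P.ρ₁ * (P.k * (P.ρ₁ / P.k)) = 1 by field_simp, one_smul]
  · rfl
  · simp only [applyA, PhaseSpace.Ψ₂_mk, hsh, hξ, p2, smul_smul]
    rw [show P.b * (1 / P.b) = 1 by field_simp, one_smul, add_sub_cancel_right, smul_smul,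
      show 1 / P.ρ₂ * P.ρ₂ = 1 by field_simp, one_smul]
  · rfl
  · have hs' : U.s = primitive P.L q := rfl
    simp only [applyA, PhaseSpace.Ψ₃_mk, hsh, hs', weakDeriv_primitive, q2, smul_smul, smul_add]
    rw [show P.b * (1 / P.b * P.ρ₂) = P.ρ₂ by field_simp,
      show P.b * (1 / P.b * (3 * P.k)) = 3 * P.k by field_simp,
      show P.b * (P.γ / P.b) = P.γ by field_simp, add_sub_right_comm, add_sub_cancel_right,
      add_sub_cancel_right, smul_smul, show 1 / P.ρ₂ * P.ρ₂ = 1 by field_simp, one_smul]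
  -- In `w_x + ξ + s` at `L` the primitives of `p` and `q` cancel, leaving `σ(L) = -F.Ψ₄`.
  · have v1 := pointValue_add P.L_pos σ1 ((H1 _).smul_mem (-1) hpq) hL
    have v2 := pointValue_smul P.L_pos (-1) hpq hL
    have v3 := pointValue_add P.L_pos (primitive_mem_H1star p).1 (primitive_mem_H1star q).1 hL
    have hξ' : U.ξ = primitive P.L p := rfl
    have hs' : U.s = primitive P.L q := rfl
    simp only [applyA, PhaseSpace.Ψ₄_mk, hw, hξ', hs', v1, v2, v3, σ3]
    ring
  · simp only [applyA, PhaseSpace.Ψ₅_mk, hξ, p3, neg_neg]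
  · simp only [applyA, PhaseSpace.Ψ₆_mk, hs, q3, neg_neg]

end

/-! ### Conservation, uniqueness and existence of solutions -/

theorem IsSolution.norm_eq {P : Beam} {U₀ : (operatorA P).domain}
    {U : NNReal → (operatorA P).domain} (hU : IsSolution P U₀ U) (t : NNReal) :
    ‖(U t : PhaseSpace P)‖ = ‖(U₀ : PhaseSpace P)‖ := by
  rw [← hU.initial]
  exact LinearPMap.norm_eq_of_hasDerivWithinAt_of_skew (inner_operatorA_self P)
    hU.hasDerivWithinAt t

/-- The difference solves the same equation with initial value `0`, and its norm is conserved. -/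
theorem IsSolution.unique {P : Beam} {U₀ : (operatorA P).domain}
    {U V : NNReal → (operatorA P).domain} (hU : IsSolution P U₀ U) (hV : IsSolution P U₀ V) :
    U = V := by
  funext t
  have h := LinearPMap.norm_eq_of_hasDerivWithinAt_of_skew (inner_operatorA_self P)
    (u := fun t => U t - V t) (fun t => by
      rw [LinearPMap.map_sub]
      exact (hU.hasDerivWithinAt t).sub (hV.hasDerivWithinAt t)) t
  rw [hU.initial, hV.initial, sub_self, ZeroMemClass.coe_zero, norm_zero, norm_eq_zero] at h
  exact sub_eq_zero.1 (Subtype.ext h)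

theorem exists_isSolution (P : Beam) (U₀ : (operatorA P).domain) :
    ∃ U : NNReal → (operatorA P).domain, IsSolution P U₀ U := by
  obtain ⟨u, hu0, huc, hud⟩ := LinearPMap.exists_hasDerivAt_of_skew_of_surjective
    (inner_operatorA_self P) (operatorA_surjective P) U₀
  -- The group gives a curve on all of `ℝ`; on `[0, ∞)` the truncation `toNNReal` changes nothing.
  have heq : EqOn (fun t : ℝ => (u (t.toNNReal : ℝ) : PhaseSpace P))
      (fun t : ℝ => (u t : PhaseSpace P)) (Ici 0) := fun t ht => by
    simp only [Real.coe_toNNReal t ht]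
  refine ⟨fun t => u t, ?_, ?_, fun t => ?_, by simpa using hu0⟩
  · have hc : Continuous fun t : ℝ => (u t : PhaseSpace P) :=
      continuous_iff_continuousAt.2 fun t => (hud t).continuousAt
    exact (hc.comp NNReal.continuous_coe).prodMk (huc.comp NNReal.continuous_coe)
  -- The derivative is `t ↦ 𝒜 u(t)`, whose continuity is `huc`.
  · have h : ContDiff ℝ 1 fun t : ℝ => (u t : PhaseSpace P) := by
      rw [contDiff_one_iff_deriv]
      refine ⟨fun t => (hud t).differentiableAt, ?_⟩
      rwa [funext fun t => (hud t).deriv]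
    exact h.contDiffOn.congr heq
  · exact (hud t).hasDerivWithinAt.congr heq (heq t.2)

theorem mainTheorem8 (P : Beam) (U₀ : (operatorA P).domain) :
    (∃! U : NNReal → (operatorA P).domain, IsSolution P U₀ U) ∧
      ∀ U : NNReal → (operatorA P).domain, IsSolution P U₀ U →
        ∀ t : NNReal, ‖(U t : PhaseSpace P)‖ ^ 2 = ‖(U₀ : PhaseSpace P)‖ ^ 2 := by
  obtain ⟨U, hU⟩ := exists_isSolution P U₀
  exact ⟨⟨U, hU, fun V hV => hV.unique hU⟩, fun V hV t => by rw [hV.norm_eq t]⟩
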